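/- **Conventions.** A complex structure $J$ on a smooth manifold is an integrable almost complex structure. For a Hermitian manifold $(M,g,J)$ put $\omega=g(J\cdot,\cdot)$ and $d^c\omega=-J\,d\omega$, i.e. $d^c\omega(X,Y,Z)=-d\omega(JX,JY,JZ)$; it is Kähler if $d\omega=0$. A generalized Kähler structure on $M$ is a triple $(h,I_+,I_-)$ of a Riemannian metric $h$ and two complex structures $I_\pm$ compatible with $h$ such that, with $\omega_\pm=h(I_\pm\cdot,\cdot)$, $d^c_+\omega_+=-d^c_-\omega_-$ and $dd^c_+\omega_+=0$. **Theorem.** Let $G$ be a compact, connected and simply connected semisimple Lie group with $\dim G\ge 3$ and with a bi-invariant metric $b$. Let $G'=G\times\mathbb R^n$ be the product Lie group with the bi-invariant metric $g'=b+g_E$, where $g_E$ is the Euclidean metric on $\mathbb R^n$, and let $J_L$ and $J_R$ be a left-invariant and a right-invariant complex structure on $G'$, both compatible with $g'$. Let $\rho:\mathbb Z^n\to \mathrm{Isom}(G)=\mathrm{Isom}(G,b)$ be a group homomorphism such that for each $m\in\mathbb Z^n$ the diffeomorphism $(q,t)\mapsto(\rho(m)q,t+m)$ of $G'$ is holomorphic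 with respect to $J_L$ and with respect to $J_R$. Let $(K,g,J)$ be a compact Kähler manifold and let $\psi:\mathbb Z^n\to\mathrm{Isom}_{hol}(K)$ be a group homomorphism into the group of holomorphic isometries of $(K,g,J)$. Then $\mathbb Z^n$ acts freely and properly discontinuously on $K\times G\times\mathbb R^n$ by $$m\cdot(p,q,t)=(\psi(m)p,\rho(m)q,t+m),$$ and the quotient $M_{\psi,\rho}=(K\times G\times\mathbb R^n)/\mathbb Z^n$ is a (Hausdorff, second countable) smooth manifold, with the projection $\pi:K\times G\times\mathbb R^n\to M_{\psi,\rho}$ a local diffeomorphism, which admits a generalized Kähler structure $(h,I_+,I_-)$ induced by $g+b+g_E$, $J\times J_R$ and $J\times J_L$; that is, $\pi^*h=g+b+g_E$, $d\pi\circ(J\times J_R)=I_+\circ d\pi$ and $d\pi\circ(J\times J_L)=I_-\circ d\pi$. -/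

import Mathlib

open scoped Manifold ContDiff Topology
open Bundle

noncomputable section

/-! ### Tensor fields and differential forms on a manifold -/

section Tensors

variable {E : Type*} [NormedAddCommGroup E] [NormedSpace ℝ E]
  {H : Type*} [TopologicalSpace H] (I : ModelWithCorners ℝ E H)
  (M : Type*) [TopologicalSpace M] [ChartedSpace H M]
  {E' : Type*} [NormedAddCommGroup E'] [NormedSpace ℝ E']
  {H' : Type*} [TopologicalSpace H'] (I' : ModelWithCorners ℝ E' H')
  (M' : Type*) [TopologicalSpace M'] [ChartedSpace H' M']

/-- Fields of endomorphisms of the tangent spaces (no regularity imposed). -/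
abbrev EndField : Type _ := ∀ x : M, TangentSpace I x →L[ℝ] TangentSpace I x

/-- Fields of bilinear forms on the tangent spaces (no regularity imposed). -/
abbrev BilinField : Type _ := ∀ x : M, TangentSpace I x →L[ℝ] TangentSpace I x →L[ℝ] ℝ

/-- Fields of alternating `k`-forms on the tangent spaces (no regularity imposed). -/
abbrev FormField (k : ℕ) : Type _ := ∀ x : M, TangentSpace I x [⋀^Fin k]→L[ℝ] ℝ

/-- Smooth Riemannian metrics on `M`. -/
abbrev SmoothMetric [IsManifold I ∞ M] : Type _ :=
  ContMDiffRiemannianMetric I ∞ E (fun x : M => TangentSpace I x)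

variable {I M I' M'}

/-- `f^* g' = g`. -/
def PullsBackMetric (f : M → M') (g : BilinField I M) (g' : BilinField I' M') : Prop :=
  ∀ (x : M) (u v : TangentSpace I x),
    g' (f x) (mfderiv I I' f x u) (mfderiv I I' f x v) = g x u v

/-- `df ∘ J = J' ∘ df`: for complex structures `J` and `J'`, the map `f` is holomorphic. -/
def Intertwines (f : M → M') (J : EndField I M) (J' : EndField I' M') : Prop :=
  ∀ (x : M) (u : TangentSpace I x), mfderiv I I' f x (J x u) = J' (f x) (mfderiv I I' f x u)

/-- The product `J × J'` on `T(M × M') = TM × TM'`. -/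
def prodEnd (J : EndField I M) (J' : EndField I' M') : EndField (I.prod I') (M × M') :=
  fun x => (J x.1).prodMap (J' x.2)

/-- The product `g + g'` on `T(M × M') = TM × TM'`. -/
def prodBilin (g : BilinField I M) (g' : BilinField I' M') : BilinField (I.prod I') (M × M') :=
  fun x =>
    letI B : E →L[ℝ] E →L[ℝ] ℝ := g x.1
    letI B' : E' →L[ℝ] E' →L[ℝ] ℝ := g' x.2
    (B.bilinearComp (ContinuousLinearMap.fst ℝ E E') (ContinuousLinearMap.fst ℝ E E') +
      B'.bilinearComp (ContinuousLinearMap.snd ℝ E E') (ContinuousLinearMap.snd ℝ E E') :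
      E × E' →L[ℝ] E × E' →L[ℝ] ℝ)

/-- The expression of a `k`-form in the preferred chart at `x₀`: its pullback under the inverse
of that chart. -/
def FormField.inChart {k : ℕ} (α : FormField I M k) (x₀ : M) (y : E) : E [⋀^Fin k]→L[ℝ] ℝ :=
  (α ((extChartAt I x₀).symm y)).compContinuousLinearMap
    (mfderivWithin 𝓘(ℝ, E) I (extChartAt I x₀).symm (Set.range I) y)

/-- The exterior derivative, computed at each point `x` in the preferred chart at `x` (for smooth
forms any other chart gives the same result). -/
def FormField.d {k : ℕ} (α : FormField I M k) : FormField I M (k + 1) := fun x =>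
  (extDerivWithin (α.inChart x) (Set.range I) (extChartAt I x x)).compContinuousLinearMap
    (mfderiv I 𝓘(ℝ, E) (extChartAt I x) x)

/-- `J` is a complex structure: a smooth field of endomorphisms with `J² = -1` which is integrable,
i.e. near every point there are smooth coordinates with values in some `ℂ^r` whose differential
carries `J` to the multiplication by `i`. -/
structure IsComplexStructure [IsManifold I ∞ M] (J : EndField I M) : Prop where
  smooth : ContMDiff I (I.prod 𝓘(ℝ, E →L[ℝ] E)) ∞
    (fun x : M => TotalSpace.mk' (E →L[ℝ] E)
      (E := fun x : M => TangentSpace I x →L[ℝ] TangentSpace I x) x (J x))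
  sq : ∀ (x : M) (u : TangentSpace I x), J x (J x u) = -u
  integrable : ∀ x : M, ∃ (r : ℕ)
    (φ : PartialDiffeomorph I 𝓘(ℝ, Fin r → ℂ) M (Fin r → ℂ) ∞),
    x ∈ φ.source ∧ ∀ y ∈ φ.source, ∀ (u : TangentSpace I y) (j : Fin r),
      (mfderiv I 𝓘(ℝ, Fin r → ℂ) φ y (J y u) : Fin r → ℂ) j =
        Complex.I * (mfderiv I 𝓘(ℝ, Fin r → ℂ) φ y u : Fin r → ℂ) j

/-- `g(Ju, Jv) = g(u, v)`. -/
def IsCompatible (g : BilinField I M) (J : EndField I M) : Prop :=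
  ∀ (x : M) (u v : TangentSpace I x), g x (J x u) (J x v) = g x u v

end Tensors

/-! ### Hermitian, Kähler and generalized Kähler structures -/

section Hermitian

variable {E : Type*} [NormedAddCommGroup E] [NormedSpace ℝ E]
  {H : Type*} [TopologicalSpace H] (I : ModelWithCorners ℝ E H)
  (M : Type*) [TopologicalSpace M] [ChartedSpace H M] [IsManifold I ∞ M]

/-- A Hermitian structure `(g, J)`. -/
structure HermitianStructure where
  metric : SmoothMetric I M
  J : EndField I M
  isComplex : IsComplexStructure J
  compatible : IsCompatible metric.inner J

variable {I M}

namespace HermitianStructure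

variable (S : HermitianStructure I M)

lemma metric_J_self (x : M) (u : TangentSpace I x) : S.metric.inner x (S.J x u) u = 0 := by
  have h := S.compatible x (S.J x u) u
  rw [S.isComplex.sq, map_neg, _root_.neg_apply, S.metric.symm] at h
  linarith

/-- The fundamental form `ω(u, v) = g(Ju, v)`. -/
def fundamentalForm : FormField I M 2 := fun x =>
  { toFun := fun v => S.metric.inner x (S.J x (v 0)) (v 1)
    map_update_add' := by
      intro inst v i a b
      obtain rfl : inst = instDecidableEqFin 2 := Subsingleton.elim _ _
      fin_cases i <;> simp [Function.update]
    map_update_smul' := by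
      intro inst v i c a
      obtain rfl : inst = instDecidableEqFin 2 := Subsingleton.elim _ _
      fin_cases i <;> simp [Function.update]
    cont := by fun_prop
    map_eq_zero_of_eq' := by
      intro v i j hij hne
      have h01 : v 0 = v 1 := by
        fin_cases i <;> fin_cases j <;> simp_all
      change S.metric.inner x (S.J x (v 0)) (v 1) = 0
      rw [← h01]
      exact S.metric_J_self x (v 0) }

/-- `d^c ω = -J dω`, i.e. `(d^c ω)(u, v, w) = -dω(Ju, Jv, Jw)`. -/
def dcOmega : FormField I M 3 := fun x =>
  -(S.fundamentalForm.d x).compContinuousLinearMap (S.J x)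

/-- The Hermitian structure is Kähler: `dω = 0`. -/
def IsKahler : Prop := S.fundamentalForm.d = 0

end HermitianStructure

variable (I M) in
/-- A generalized Kähler structure `(g, I₊, I₋)`: two Hermitian structures with the same metric,
such that `d^c₊ ω₊ = -d^c₋ ω₋` and `d d^c₊ ω₊ = 0`. -/
structure GeneralizedKahlerStructure where
  plus : HermitianStructure I M
  minus : HermitianStructure I M
  same_metric : plus.metric = minus.metric
  torsion_eq : plus.dcOmega = -minus.dcOmega
  torsion_closed : FormField.d plus.dcOmega = 0

/-- The group of (smooth) Riemannian isometries of `(M, g)`. -/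
def isomGroup (g : SmoothMetric I M) : Subgroup (Equiv.Perm M) where
  carrier := {f | ContMDiff I I ∞ f ∧ ContMDiff I I ∞ f.symm ∧
    PullsBackMetric f g.inner g.inner}
  one_mem' := by
    refine ⟨contMDiff_id, contMDiff_id, fun x u v => ?_⟩
    have : mfderiv I I ((1 : Equiv.Perm M) : M → M) x = ContinuousLinearMap.id ℝ _ := mfderiv_id
    rw [this]; rfl
  mul_mem' := by
    rintro f h ⟨hf, hf', hfg⟩ ⟨hh, hh', hhg⟩
    refine ⟨hf.comp hh, hh'.comp hf', fun x u v => ?_⟩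
    have : mfderiv I I ((f * h : Equiv.Perm M) : M → M) x =
        (mfderiv I I f (h x)).comp (mfderiv I I h x) :=
      mfderiv_comp x (hf.mdifferentiableAt (by simp)) (hh.mdifferentiableAt (by simp))
    rw [this]
    exact (hfg (h x) _ _).trans (hhg x u v)
  inv_mem' := by
    rintro f ⟨hf, hf', hfg⟩
    refine ⟨hf', hf, fun x u v => ?_⟩
    have key : ∀ w : TangentSpace I x,
        mfderiv I I f (f.symm x) (mfderiv I I f.symm x w) = w := by
      intro w
      have h1 := mfderiv_comp x (hf.mdifferentiableAt (x := f.symm x) (by simp))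
        (hf'.mdifferentiableAt (x := x) (by simp))
      have h2 : (f : M → M) ∘ f.symm = id := by ext y; simp
      rw [h2, mfderiv_id] at h1
      exact (congrArg (fun L => L w) h1).symm
    have h3 := hfg (f.symm x) (mfderiv I I f.symm x u) (mfderiv I I f.symm x v)
    rw [key, key] at h3
    refine h3.symm.trans ?_
    congr 1
    rw [Equiv.apply_symm_apply]

/-- The group of holomorphic isometries of a Hermitian manifold `(M, g, J)`. -/
def holIsomGroup (S : HermitianStructure I M) : Subgroup (Equiv.Perm M) where
  carrier := {f | f ∈ isomGroup S.metric ∧ Intertwines f S.J S.J}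
  one_mem' := by
    refine ⟨one_mem _, fun x u => ?_⟩
    have : mfderiv I I ((1 : Equiv.Perm M) : M → M) x = ContinuousLinearMap.id ℝ _ := mfderiv_id
    rw [this]; rfl
  mul_mem' := by
    rintro f h ⟨hf, hfJ⟩ ⟨hh, hhJ⟩
    refine ⟨mul_mem hf hh, fun x u => ?_⟩
    have : mfderiv I I ((f * h : Equiv.Perm M) : M → M) x =
        (mfderiv I I f (h x)).comp (mfderiv I I h x) :=
      mfderiv_comp x (hf.1.mdifferentiableAt (by simp)) (hh.1.mdifferentiableAt (by simp))
    rw [this]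
    exact (congrArg (mfderiv I I f (h x)) (hhJ x u)).trans (hfJ (h x) _)
  inv_mem' := by
    rintro f ⟨hf, hfJ⟩
    refine ⟨inv_mem hf, fun x u => ?_⟩
    have inv_left : ∀ (y : M) (w : TangentSpace I y),
        mfderiv I I f.symm (f y) (mfderiv I I f y w) = w := by
      intro y w
      have h1 := mfderiv_comp y (hf.2.1.mdifferentiableAt (x := f y) (by simp))
        (hf.1.mdifferentiableAt (x := y) (by simp))
      have h2 : (f.symm : M → M) ∘ f = id := by ext z; simp
      rw [h2, mfderiv_id] at h1
      exact (congrArg (fun L => L w) h1).symm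
    have inv_right : ∀ (y : M) (w : TangentSpace I (f y)),
        mfderiv I I f y (mfderiv I I f.symm (f y) w) = w := by
      intro y w
      have h1 := mfderiv_comp (f y) (hf.1.mdifferentiableAt (x := f.symm (f y)) (by simp))
        (hf.2.1.mdifferentiableAt (x := f y) (by simp))
      have h2 : (f : M → M) ∘ f.symm = id := by ext z; simp
      rw [h2, mfderiv_id, Equiv.symm_apply_apply] at h1
      exact (congrArg (fun L => L w) h1).symm
    obtain ⟨y, rfl⟩ := f.surjective x
    change mfderiv I I f.symm (f y) (S.J (f y) u) =
      S.J (f.symm (f y)) (mfderiv I I f.symm (f y) u)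
    have h3 := hfJ y (mfderiv I I f.symm (f y) u)
    rw [inv_right] at h3
    rw [← h3, inv_left, Equiv.symm_apply_apply]

end Hermitian

/-! ### The quotient of `K × G × ℝⁿ` by `ℤⁿ` -/

/-- The Euclidean metric on `ℝⁿ`. -/
def euclideanBilin (n : ℕ) :
    BilinField 𝓘(ℝ, EuclideanSpace ℝ (Fin n)) (EuclideanSpace ℝ (Fin n)) :=
  fun _ => (innerSL ℝ : EuclideanSpace ℝ (Fin n) →L[ℝ] EuclideanSpace ℝ (Fin n) →L[ℝ] ℝ)

/-- The inclusion `ℤⁿ → ℝⁿ`; the group `ℤⁿ` is written multiplicatively. -/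
def latticeVec {n : ℕ} (m : Multiplicative (Fin n → ℤ)) : EuclideanSpace ℝ (Fin n) :=
  WithLp.toLp 2 fun i => ((Multiplicative.toAdd m i : ℤ) : ℝ)

section LieGroup

variable {E : Type*} [NormedAddCommGroup E] [NormedSpace ℝ E]
  {H : Type*} [TopologicalSpace H] (I : ModelWithCorners ℝ E H)
  (G : Type*) [TopologicalSpace G] [ChartedSpace H G] [Group G]

/-- The Lie group `G` is semisimple: its Lie algebra is. -/
def IsSemisimpleLieGroup [FiniteDimensional ℝ E] [LieGroup I ∞ G] : Prop :=
  haveI : CompleteSpace E := FiniteDimensional.complete ℝ E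
  haveI : LieGroup I (minSmoothness ℝ 3) G := LieGroup.of_le (n := ∞) (by
    rw [minSmoothness_of_isRCLikeNormedField]
    exact ENat.LEInfty.out)
  LieAlgebra.IsSemisimple ℝ (GroupLieAlgebra I G)

variable {G}

/-- The metric `b` on `G` is bi-invariant: left and right translations are isometries. -/
def IsBiInvariantMetric (b : BilinField I G) : Prop :=
  ∀ a : G, PullsBackMetric (I := I) (I' := I) (fun x => a * x) b b ∧
    PullsBackMetric (I := I) (I' := I) (fun x => x * a) b b

variable {n : ℕ} {I}

/-- `J` is invariant under the left translations of the Lie group `G × ℝⁿ`. -/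
def IsLeftInvariant
    (J : EndField (I.prod 𝓘(ℝ, EuclideanSpace ℝ (Fin n))) (G × EuclideanSpace ℝ (Fin n))) :
    Prop :=
  ∀ a : G × EuclideanSpace ℝ (Fin n), Intertwines (fun x => (a.1 * x.1, a.2 + x.2)) J J

/-- `J` is invariant under the right translations of the Lie group `G × ℝⁿ`. -/
def IsRightInvariant
    (J : EndField (I.prod 𝓘(ℝ, EuclideanSpace ℝ (Fin n))) (G × EuclideanSpace ℝ (Fin n))) :
    Prop :=
  ∀ a : G × EuclideanSpace ℝ (Fin n), Intertwines (fun x => (x.1 * a.1, x.2 + a.2)) J J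

end LieGroup

section Quotient

variable {K G : Type*} {n : ℕ} {A : Subgroup (Equiv.Perm K)} {B : Subgroup (Equiv.Perm G)}

/-- The action of `ℤⁿ` on `K × G × ℝⁿ` by `m • (p, q, t) = (ψ(m) p, ρ(m) q, t + m)`. -/
abbrev latticeAction (ψ : Multiplicative (Fin n → ℤ) →* A)
    (ρ : Multiplicative (Fin n → ℤ) →* B) :
    MulAction (Multiplicative (Fin n → ℤ)) (K × G × EuclideanSpace ℝ (Fin n)) where
  smul m x := ((ψ m : Equiv.Perm K) x.1, (ρ m : Equiv.Perm G) x.2.1, x.2.2 + latticeVec m)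
  one_smul x := by
    refine Prod.ext ?_ (Prod.ext ?_ ?_)
    · change (ψ 1 : Equiv.Perm K) x.1 = x.1
      simp
    · change (ρ 1 : Equiv.Perm G) x.2.1 = x.2.1
      simp
    · change x.2.2 + latticeVec 1 = x.2.2
      ext i; simp [latticeVec]
  mul_smul m m' x := by
    refine Prod.ext ?_ (Prod.ext ?_ ?_)
    · change (ψ (m * m') : Equiv.Perm K) x.1 = (ψ m : Equiv.Perm K) ((ψ m' : Equiv.Perm K) x.1)
      simp
    · change (ρ (m * m') : Equiv.Perm G) x.2.1 =
        (ρ m : Equiv.Perm G) ((ρ m' : Equiv.Perm G) x.2.1)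
      simp
    · change x.2.2 + latticeVec (m * m') = x.2.2 + latticeVec m' + latticeVec m
      ext i; simp [latticeVec]; ring

/-- The quotient `M_{ψ,ρ} = (K × G × ℝⁿ) / ℤⁿ`. -/
def LatticeQuotient (ψ : Multiplicative (Fin n → ℤ) →* A)
    (ρ : Multiplicative (Fin n → ℤ) →* B) : Type _ :=
  letI := latticeAction ψ ρ
  MulAction.orbitRel.Quotient (Multiplicative (Fin n → ℤ)) (K × G × EuclideanSpace ℝ (Fin n))

/-- The projection `K × G × ℝⁿ → M_{ψ,ρ}`. -/
def LatticeQuotient.mk (ψ : Multiplicative (Fin n → ℤ) →* A)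
    (ρ : Multiplicative (Fin n → ℤ) →* B) (x : K × G × EuclideanSpace ℝ (Fin n)) :
    LatticeQuotient ψ ρ :=
  letI := latticeAction ψ ρ
  Quotient.mk (MulAction.orbitRel (Multiplicative (Fin n → ℤ))
    (K × G × EuclideanSpace ℝ (Fin n))) x

/-- The quotient topology. -/
instance [TopologicalSpace K] [TopologicalSpace G] (ψ : Multiplicative (Fin n → ℤ) →* A)
    (ρ : Multiplicative (Fin n → ℤ) →* B) : TopologicalSpace (LatticeQuotient ψ ρ) :=
  TopologicalSpace.coinduced (LatticeQuotient.mk ψ ρ) inferInstance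

end Quotient

end

set_option linter.unusedSectionVars false

noncomputable section

/-! ### Pullback of forms and naturality of the exterior derivative -/

section Forms

variable {F : Type*} [NormedAddCommGroup F] [NormedSpace ℝ F]
  {E : Type*} [NormedAddCommGroup E] [NormedSpace ℝ E]
  {H : Type*} [TopologicalSpace H] {I : ModelWithCorners ℝ E H}
  {M : Type*} [TopologicalSpace M] [ChartedSpace H M]
  {E' : Type*} [NormedAddCommGroup E'] [NormedSpace ℝ E']
  {H' : Type*} [TopologicalSpace H'] {I' : ModelWithCorners ℝ E' H'}
  {M' : Type*} [TopologicalSpace M'] [ChartedSpace H' M']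

/-- The pullback `f^* α`. -/
def FormField.pullback {k : ℕ} (f : M → M') (α : FormField I' M' k) : FormField I M k :=
  fun x => (α (f x)).compContinuousLinearMap (mfderiv I I' f x)

/-- The expression of `α` in each preferred chart is differentiable at the base point. -/
def FormField.IsDifferentiable {k : ℕ} (α : FormField I M k) : Prop :=
  ∀ x : M, DifferentiableAt ℝ (α.inChart x) (extChartAt I x x)

/-- The value of a form at a point, as a form on the model space. -/
def FormField.val {k : ℕ} (α : FormField I M k) (x : M) : E [⋀^Fin k]→L[ℝ] ℝ := α x

lemma FormField.ext_val {k : ℕ} {α β : FormField I M k}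
    (h : ∀ x (v : Fin k → E), α.val x v = β.val x v) : α = β :=
  funext fun x => ContinuousAlternatingMap.ext (h x)

variable [I.Boundaryless] [I'.Boundaryless] [IsManifold I ∞ M] [IsManifold I' ∞ M']

/-- The differential of the inverse of the preferred chart at `x₀`, as a map from `E`. -/
def frameAt (I : ModelWithCorners ℝ E H) {M : Type*} [TopologicalSpace M] [ChartedSpace H M]
    (x₀ : M) (y : E) : E →L[ℝ] E :=
  mfderivWithin 𝓘(ℝ, E) I (extChartAt I x₀).symm (Set.range I) y

/-- The differential of the preferred chart at `x₀`, as a map to `E`. -/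
def coframeAt (I : ModelWithCorners ℝ E H) {M : Type*} [TopologicalSpace M] [ChartedSpace H M]
    (x₀ : M) (x : M) : E →L[ℝ] E :=
  mfderiv I 𝓘(ℝ, E) (extChartAt I x₀) x

/-- The differential of `f` at `x`, as a map between the model spaces. -/
def diffAt (I : ModelWithCorners ℝ E H) (I' : ModelWithCorners ℝ E' H') (f : M → M') (x : M) :
    E →L[ℝ] E' :=
  mfderiv I I' f x

lemma coframeAt_comp_frameAt {x₀ : M} {y : E} (hy : y ∈ (extChartAt I x₀).target) (v : E) :
    coframeAt I x₀ ((extChartAt I x₀).symm y) (frameAt I x₀ y v) = v :=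
  congrArg (fun L : E →L[ℝ] E => L v)
    (mfderiv_extChartAt_comp_mfderivWithin_extChartAt_symm (I := I) hy)

lemma frameAt_comp_coframeAt {x₀ : M} {y : E} (hy : y ∈ (extChartAt I x₀).target) (v : E) :
    frameAt I x₀ y (coframeAt I x₀ ((extChartAt I x₀).symm y) v) = v :=
  congrArg (fun L : E →L[ℝ] E => L v)
    (mfderivWithin_extChartAt_symm_comp_mfderiv_extChartAt (I := I) hy)

lemma frameAt_self (x : M) (v : E) : frameAt I x (extChartAt I x x) v = v :=
  congrArg (fun L : E →L[ℝ] E => L v) (mfderivWithin_range_extChartAt_symm (I := I) (x := x))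

lemma coframeAt_self (x : M) (v : E) : coframeAt I x x v = v :=
  congrArg (fun L : E →L[ℝ] E => L v) (mfderiv_extChartAt_self (I := I) (x := x))

lemma FormField.inChart_apply {k : ℕ} (α : FormField I M k) (x₀ : M) (y : E) (v : Fin k → E) :
    α.inChart x₀ y v = (α.val ((extChartAt I x₀).symm y))
      (fun i => frameAt I x₀ y (v i)) := rfl

lemma FormField.d_apply {k : ℕ} (α : FormField I M k) (x : M) (v : Fin (k + 1) → E) :
    α.d.val x v =
      extDeriv (α.inChart x) (extChartAt I x x) (fun i => coframeAt I x x (v i)) := by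
  rw [← extDerivWithin_univ, ← I.range_eq_univ]; rfl

lemma FormField.pullback_apply {k : ℕ} (f : M → M') (α : FormField I' M' k) (x : M)
    (v : Fin k → E) :
    (α.pullback (I := I) f).val x v =
      (α.val (f x)) (fun i => diffAt I I' f x (v i)) := rfl

lemma mdifferentiableAt_extChartAt_symm {x₀ : M} {y : E} (hy : y ∈ (extChartAt I x₀).target) :
    MDifferentiableAt 𝓘(ℝ, E) I (extChartAt I x₀).symm y :=
  mdifferentiableOn_extChartAt_symm.mdifferentiableAt
    ((isOpen_extChartAt_target x₀).mem_nhds hy)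

lemma mdifferentiableAt_extChartAt_of_mem {x₀ x : M} (hx : x ∈ (extChartAt I x₀).source) :
    MDifferentiableAt I 𝓘(ℝ, E) (extChartAt I x₀) x :=
  mdifferentiableAt_extChartAt (by rwa [extChartAt_source] at hx)

lemma contMDiffAt_extChartAt_symm {x₀ : M} {y : E} (hy : y ∈ (extChartAt I x₀).target) :
    ContMDiffAt 𝓘(ℝ, E) I ∞ (extChartAt I x₀).symm y :=
  (contMDiffOn_extChartAt_symm x₀).contMDiffAt
    ((isOpen_extChartAt_target x₀).mem_nhds hy)

lemma contMDiffAt_extChartAt_of_mem {x₀ x : M} (hx : x ∈ (extChartAt I x₀).source) :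
    ContMDiffAt I 𝓘(ℝ, E) ∞ (extChartAt I x₀) x :=
  contMDiffAt_extChartAt' (by rwa [extChartAt_source] at hx)

lemma frameAt_eq_diffAt (x₀ : M) (y : E) :
    frameAt I x₀ y = diffAt 𝓘(ℝ, E) I (extChartAt I x₀).symm y := by
  unfold frameAt diffAt
  rw [I.range_eq_univ, mfderivWithin_univ]

lemma diffAt_comp {E'' : Type*} [NormedAddCommGroup E''] [NormedSpace ℝ E'']
    {H'' : Type*} [TopologicalSpace H''] {I'' : ModelWithCorners ℝ E'' H''}
    {M'' : Type*} [TopologicalSpace M''] [ChartedSpace H'' M'']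
    {g : M' → M''} {f : M → M'} {x : M} (hg : MDifferentiableAt I' I'' g (f x))
    (hf : MDifferentiableAt I I' f x) :
    diffAt I I'' (fun z => g (f z)) x = (diffAt I' I'' g (f x)).comp (diffAt I I' f x) :=
  mfderiv_comp x hg hf

lemma diffAt_congr {f g : M → M'} {x : M} (h : f =ᶠ[𝓝 x] g) :
    diffAt I I' f x = diffAt I I' g x := h.mfderiv_eq

lemma diffAt_id (x : M) : diffAt I I (fun z : M => z) x = ContinuousLinearMap.id ℝ E :=
  mfderiv_id

/-- Chain rule in the preferred chart at `f p`, for maps from a normed space. -/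
lemma diffAt_eq_frameAt_comp_fderiv {f : F → M} {x₀ : M} {p : F}
    (hf : MDifferentiableAt 𝓘(ℝ, F) I f p) (hp : f p ∈ (extChartAt I x₀).source) :
    diffAt 𝓘(ℝ, F) I f p =
      (frameAt I x₀ (extChartAt I x₀ (f p))).comp (fderiv ℝ (fun y => extChartAt I x₀ (f y)) p) := by
  have h1 : f =ᶠ[𝓝 p] fun y => (extChartAt I x₀).symm (extChartAt I x₀ (f y)) := by
    filter_upwards [hf.continuousAt.preimage_mem_nhds
      ((isOpen_extChartAt_source x₀).mem_nhds hp)] with y hy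
    exact ((extChartAt I x₀).left_inv hy).symm
  have h2 : MDifferentiableAt 𝓘(ℝ, F) 𝓘(ℝ, E) (fun y => extChartAt I x₀ (f y)) p :=
    (mdifferentiableAt_extChartAt_of_mem hp).comp p hf
  rw [diffAt_congr h1, diffAt_comp (g := (extChartAt I x₀).symm)
    (f := fun y => extChartAt I x₀ (f y))
    (mdifferentiableAt_extChartAt_symm ((extChartAt I x₀).map_source hp)) h2, frameAt_eq_diffAt]
  congr 1
  exact mfderiv_eq_fderiv

lemma fderiv_chart_comp {f : F → M} {x₀ : M} {p : F}
    (hf : MDifferentiableAt 𝓘(ℝ, F) I f p) (hp : f p ∈ (extChartAt I x₀).source) :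
    fderiv ℝ (fun y => extChartAt I x₀ (f y)) p =
      (coframeAt I x₀ (f p)).comp (diffAt 𝓘(ℝ, F) I f p) := by
  rw [← mfderiv_eq_fderiv]
  exact diffAt_comp (mdifferentiableAt_extChartAt_of_mem hp) hf

/-- `d` commutes with the pullback to a normed space. -/
theorem FormField.extDeriv_pullback_normed {k : ℕ} {α : FormField I M k} {f : F → M} {p : F}
    (hf : ContMDiffAt 𝓘(ℝ, F) I ∞ f p)
    (hα : DifferentiableAt ℝ (α.inChart (f p)) (extChartAt I (f p) (f p))) (v : Fin (k + 1) → F) :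
    extDeriv (fun y => (α.val (f y)).compContinuousLinearMap
        (diffAt 𝓘(ℝ, F) I f y)) p v =
      α.d.val (f p) (fun i => diffAt 𝓘(ℝ, F) I f p (v i)) := by
  set x₀ := f p with hx₀
  have h1 : ∀ᶠ y in 𝓝 p, f y ∈ (extChartAt I x₀).source :=
    hf.continuousAt.preimage_mem_nhds ((isOpen_extChartAt_source x₀).mem_nhds
      (mem_extChartAt_source x₀))
  have h2 : ∀ᶠ y in 𝓝 p, MDifferentiableAt 𝓘(ℝ, F) I f y := by
    filter_upwards [(contMDiffAt_iff_contMDiffAt_nhds (by simp)).1 (hf.of_le (m := 1) (by simp))] with y hy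
    exact hy.mdifferentiableAt one_ne_zero
  have h3 : (fun y => (α.val (f y)).compContinuousLinearMap
        (diffAt 𝓘(ℝ, F) I f y)) =ᶠ[𝓝 p]
      fun y => (α.inChart x₀ (extChartAt I x₀ (f y))).compContinuousLinearMap
        (fderiv ℝ (fun y => extChartAt I x₀ (f y)) y) := by
    filter_upwards [h1, h2] with y hy hy'
    ext w
    rw [ContinuousAlternatingMap.compContinuousLinearMap_apply,
      ContinuousAlternatingMap.compContinuousLinearMap_apply, FormField.inChart_apply,
      diffAt_eq_frameAt_comp_fderiv hy' hy,
      (extChartAt I x₀).left_inv hy]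
    rfl
  have h4 : ContDiffAt ℝ ∞ (fun y => extChartAt I x₀ (f y)) p :=
    contMDiffAt_iff_contDiffAt.1
      ((contMDiffAt_extChartAt_of_mem (mem_extChartAt_source x₀)).comp p hf)
  rw [h3.extDeriv_eq, extDeriv_pullback (f := fun y => extChartAt I x₀ (f y)) hα h4
    (by rw [minSmoothness_of_isRCLikeNormedField]; exact ENat.LEInfty.out),
    ContinuousAlternatingMap.compContinuousLinearMap_apply,
    FormField.d_apply, fderiv_chart_comp (hf.mdifferentiableAt (by simp)) (mem_extChartAt_source x₀)]
  rfl

/-- In the chart at `x₀`, the exterior derivative is the one of normed spaces. -/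
theorem FormField.inChart_d {k : ℕ} {α : FormField I M k} (hα : α.IsDifferentiable) {x₀ : M} {y : E}
    (hy : y ∈ (extChartAt I x₀).target) :
    α.d.inChart x₀ y = extDeriv (α.inChart x₀) y := by
  ext v
  have h := FormField.extDeriv_pullback_normed (contMDiffAt_extChartAt_symm hy)
    (hα _) v
  rw [FormField.inChart_apply, frameAt_eq_diffAt, ← h]
  refine congrArg (fun θ => extDeriv θ y v) (funext fun y' => ?_)
  rw [← frameAt_eq_diffAt]; rfl

/-- `d f^* = f^* d`. -/
theorem FormField.d_pullback {k : ℕ} {α : FormField I' M' k} (hα : α.IsDifferentiable) {f : M → M'}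
    (hf : ContMDiff I I' ∞ f) :
    (α.pullback (I := I) f).d = α.d.pullback f := by
  refine FormField.ext_val fun x v => ?_
  have hx := (extChartAt I x).left_inv (mem_extChartAt_source x)
  have h1 : ContMDiffAt 𝓘(ℝ, E) I' ∞ (fun y => f ((extChartAt I x).symm y)) (extChartAt I x x) :=
    hf.contMDiffAt.comp _ (contMDiffAt_extChartAt_symm (mem_extChartAt_target x))
  have h := FormField.extDeriv_pullback_normed h1 (hα _)
    (fun i => coframeAt I x x (v i))
  refine (FormField.d_apply _ x v).trans (Eq.trans ?_ (h.trans ?_))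
  · congr 1
    refine Filter.EventuallyEq.extDeriv_eq ?_
    filter_upwards [(isOpen_extChartAt_target x).mem_nhds (mem_extChartAt_target x)] with y hy
    ext w
    rw [FormField.inChart_apply, FormField.pullback_apply,
      ContinuousAlternatingMap.compContinuousLinearMap_apply,
      diffAt_comp (hf.mdifferentiable (by simp) _) (mdifferentiableAt_extChartAt_symm hy), ← frameAt_eq_diffAt]
    rfl
  · rw [hx]
    refine Eq.trans ?_ (FormField.pullback_apply f α.d x v).symm
    congr 1
    ext i
    rw [diffAt_comp (hf.mdifferentiable (by simp) _) (mdifferentiableAt_extChartAt_symm (mem_extChartAt_target x)),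
      ← frameAt_eq_diffAt]
    simp only [ContinuousLinearMap.comp_apply]
    rw [frameAt_self, coframeAt_self, hx]

end Forms

section FiniteDimensional

variable {P : Type*} [NormedAddCommGroup P] [NormedSpace ℝ P]
  {E : Type*} [NormedAddCommGroup E] [NormedSpace ℝ E] [FiniteDimensional ℝ E]
  {W : Type*} [NormedAddCommGroup W] [NormedSpace ℝ W] [FiniteDimensional ℝ W]
  {V : Type*} [NormedAddCommGroup V] [NormedSpace ℝ V]

/-- Smoothness may be tested on finitely many linear coordinates that separate points. -/
lemma contDiffAt_of_injective_linearMap {S : Type*} [Fintype S] (ev : V →ₗ[ℝ] (S → W))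
    (hinj : Function.Injective ev) {f : P → V} {p : P}
    (h : ∀ s, ContDiffAt ℝ ∞ (fun y => ev (f y) s) p) : ContDiffAt ℝ ∞ f p := by
  obtain ⟨l, hl⟩ := ev.exists_leftInverse_of_injective (LinearMap.ker_eq_bot.2 hinj)
  have hf : f = fun y => l.toContinuousLinearMap (ev (f y)) :=
    funext fun y => (congrArg (fun L => L (f y)) hl).symm
  rw [hf]
  refine l.toContinuousLinearMap.contDiff.contDiffAt.comp p ?_
  exact contDiffAt_pi.2 h

/-- A family of alternating forms on a finite-dimensional space is smooth as soon as its values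
on fixed vectors are. -/
lemma contDiffAt_alternating_of_apply {k : ℕ} {f : P → E [⋀^Fin k]→L[ℝ] ℝ} {p : P}
    (h : ∀ v : Fin k → E, ContDiffAt ℝ ∞ (fun y => f y v) p) : ContDiffAt ℝ ∞ f p := by
  let bs := Module.finBasis ℝ E
  let ev : (E [⋀^Fin k]→L[ℝ] ℝ) →ₗ[ℝ] ((Fin k → Fin (Module.finrank ℝ E)) → ℝ) :=
    { toFun := fun α s => α fun i => bs (s i)
      map_add' := fun _ _ => rfl
      map_smul' := fun _ _ => rfl }
  refine contDiffAt_of_injective_linearMap ev (fun α β hab => ?_) fun s => h _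
  apply ContinuousAlternatingMap.toAlternatingMap_injective
  apply AlternatingMap.coe_multilinearMap_injective
  exact Module.Basis.ext_multilinear (fun _ => bs) fun s => congrFun hab s

/-- A family of linear maps between finite-dimensional spaces is smooth as soon as its values
on fixed vectors are. -/
lemma contDiffAt_clm_of_apply {f : P → E →L[ℝ] W} {p : P}
    (h : ∀ v : E, ContDiffAt ℝ ∞ (fun y => f y v) p) : ContDiffAt ℝ ∞ f p := by
  let bs := Module.finBasis ℝ E
  let ev : (E →L[ℝ] W) →ₗ[ℝ] (Fin (Module.finrank ℝ E) → W) :=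
    { toFun := fun α s => α (bs s)
      map_add' := fun _ _ => rfl
      map_smul' := fun _ _ => rfl }
  refine contDiffAt_of_injective_linearMap ev (fun α β hab => ?_) fun s => h _
  apply ContinuousLinearMap.coe_injective
  exact bs.ext fun s => congrFun hab s

lemma contDiffAt_bilin_of_apply {f : P → E →L[ℝ] E →L[ℝ] ℝ} {p : P}
    (h : ∀ u v : E, ContDiffAt ℝ ∞ (fun y => f y u v) p) : ContDiffAt ℝ ∞ f p :=
  contDiffAt_clm_of_apply fun u => contDiffAt_clm_of_apply (h u)

end FiniteDimensional

/-! ### Tensors in charts -/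

section TensorCharts

variable {F : Type*} [NormedAddCommGroup F] [NormedSpace ℝ F]
  {E : Type*} [NormedAddCommGroup E] [NormedSpace ℝ E]
  {H : Type*} [TopologicalSpace H] {I : ModelWithCorners ℝ E H}
  {M : Type*} [TopologicalSpace M] [ChartedSpace H M]
  {E' : Type*} [NormedAddCommGroup E'] [NormedSpace ℝ E']
  {H' : Type*} [TopologicalSpace H'] {I' : ModelWithCorners ℝ E' H'}
  {M' : Type*} [TopologicalSpace M'] [ChartedSpace H' M']
  [I.Boundaryless] [I'.Boundaryless] [IsManifold I ∞ M] [IsManifold I' ∞ M']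

/-- The value of a field of endomorphisms at a point, on the model space. -/
def EndField.val (J : EndField I M) (x : M) : E →L[ℝ] E := J x

/-- The value of a field of bilinear forms at a point, on the model space. -/
def BilinField.val (g : BilinField I M) (x : M) : E →L[ℝ] E →L[ℝ] ℝ := g x

/-- The expression of a field of endomorphisms in the preferred chart at `x₀`. -/
def EndField.inChart (J : EndField I M) (x₀ : M) (y : E) : E →L[ℝ] E :=
  (coframeAt I x₀ ((extChartAt I x₀).symm y)).comp
    ((J.val ((extChartAt I x₀).symm y)).comp (frameAt I x₀ y))

/-- The expression of a field of bilinear forms in the preferred chart at `x₀`. -/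
def BilinField.inChart (g : BilinField I M) (x₀ : M) (y : E) : E →L[ℝ] E →L[ℝ] ℝ :=
  (g.val ((extChartAt I x₀).symm y)).bilinearComp (frameAt I x₀ y) (frameAt I x₀ y)

lemma contMDiffAt_comp_extChartAt_iff {f : E → F} {h : M → F} {x₀ : M}
    (hfh : h =ᶠ[𝓝 x₀] fun x => f (extChartAt I x₀ x)) :
    ContMDiffAt I 𝓘(ℝ, F) ∞ h x₀ ↔ ContDiffAt ℝ ∞ f (extChartAt I x₀ x₀) := by
  rw [hfh.contMDiffAt_iff]
  constructor
  · intro H1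
    have h2 : ContMDiffAt 𝓘(ℝ, E) 𝓘(ℝ, F) ∞
        (fun y => f (extChartAt I x₀ ((extChartAt I x₀).symm y))) (extChartAt I x₀ x₀) := by
      refine ContMDiffAt.comp (I' := I) (f := (extChartAt I x₀).symm)
        (g := fun x => f (extChartAt I x₀ x)) _ ?_
        (contMDiffAt_extChartAt_symm (mem_extChartAt_target x₀))
      rwa [(extChartAt I x₀).left_inv (mem_extChartAt_source x₀)]
    refine (contMDiffAt_iff_contDiffAt.1 h2).congr_of_eventuallyEq ?_
    filter_upwards [(isOpen_extChartAt_target x₀).mem_nhds (mem_extChartAt_target (I := I) x₀)]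
      with y hy
    rw [(extChartAt I x₀).right_inv hy]
  · intro H1
    exact (contMDiffAt_iff_contDiffAt.2 H1).comp x₀ contMDiffAt_extChartAt

lemma EndField.contMDiffAt_iff {J : EndField I M} {x₀ : M} :
    ContMDiffAt I (I.prod 𝓘(ℝ, E →L[ℝ] E)) ∞
      (fun x : M => TotalSpace.mk' (E →L[ℝ] E)
        (E := fun x : M => TangentSpace I x →L[ℝ] TangentSpace I x) x (J x)) x₀ ↔
      ContDiffAt ℝ ∞ (J.inChart x₀) (extChartAt I x₀ x₀) := by
  rw [contMDiffAt_hom_bundle]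
  simp only
  refine (and_iff_right (contMDiffAt_id (I := I))).trans ?_
  refine contMDiffAt_comp_extChartAt_iff ?_
  filter_upwards [(chartAt H x₀).open_source.mem_nhds (mem_chart_source H x₀)] with x hx
  unfold ContinuousLinearMap.inCoordinates
  rw [TangentBundle.continuousLinearMapAt_trivializationAt hx,
    TangentBundle.symmL_trivializationAt hx]
  unfold EndField.inChart
  rw [(extChartAt I x₀).left_inv (by rwa [extChartAt_source])]
  rfl

lemma BilinField.contMDiffAt_iff [FiniteDimensional ℝ E] {g : BilinField I M} {x₀ : M} :
    ContMDiffAt I (I.prod 𝓘(ℝ, E →L[ℝ] E →L[ℝ] ℝ)) ∞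
      (fun x : M => TotalSpace.mk' (E →L[ℝ] E →L[ℝ] ℝ)
        (E := fun x : M => TangentSpace I x →L[ℝ] TangentSpace I x →L[ℝ] ℝ) x (g x)) x₀ ↔
      ContDiffAt ℝ ∞ (g.inChart x₀) (extChartAt I x₀ x₀) := by
  rw [contMDiffAt_hom_bundle]
  simp only
  refine (and_iff_right (contMDiffAt_id (I := I))).trans ?_
  refine contMDiffAt_comp_extChartAt_iff ?_
  filter_upwards [(chartAt H x₀).open_source.mem_nhds (mem_chart_source H x₀)] with x hx
  ext u v
  have h := inCoordinates_apply_eq₂ (B := M) (F₁ := E) (F₂ := E) (F₃ := ℝ)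
    (E₁ := fun x : M => TangentSpace I x) (E₂ := fun x : M => TangentSpace I x)
    (E₃ := Bundle.Trivial M ℝ) (x₀ := x₀) (x := x) (ϕ := g x) (v := u) (w := v) hx hx
    (by simp)
  refine h.trans ?_
  have hs : ∀ w : E, (trivializationAt E (TangentSpace I) x₀).symm x w =
      frameAt I x₀ (extChartAt I x₀ x) w := fun w =>
    ((trivializationAt E (TangentSpace I) x₀).symmL_apply (R := ℝ) hx w).symm.trans
      (congrArg (fun L : E →L[ℝ] E => L w) (TangentBundle.symmL_trivializationAt (I := I) hx))
  rw [hs, hs]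
  unfold BilinField.inChart
  rw [(extChartAt I x₀).left_inv (by rwa [extChartAt_source])]
  simp
  rfl

end TensorCharts

/-! ### Pullback of tensors -/

section TensorPullback

variable {F : Type*} [NormedAddCommGroup F] [NormedSpace ℝ F]
  {E : Type*} [NormedAddCommGroup E] [NormedSpace ℝ E]
  {H : Type*} [TopologicalSpace H] {I : ModelWithCorners ℝ E H}
  {M : Type*} [TopologicalSpace M] [ChartedSpace H M]
  {E' : Type*} [NormedAddCommGroup E'] [NormedSpace ℝ E']
  {H' : Type*} [TopologicalSpace H'] {I' : ModelWithCorners ℝ E' H'}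
  {M' : Type*} [TopologicalSpace M'] [ChartedSpace H' M']
  [I.Boundaryless] [I'.Boundaryless] [IsManifold I ∞ M] [IsManifold I' ∞ M']

variable (I I') in
/-- The expression of `f` in the preferred charts at `x₀` and `f x₀`. -/
def chartMap (f : M → M') (x₀ : M) (y : E) : E' :=
  extChartAt I' (f x₀) (f ((extChartAt I x₀).symm y))

omit [IsManifold I ∞ M] [I.Boundaryless] [I'.Boundaryless] [IsManifold I' ∞ M'] in
lemma chartMap_self (f : M → M') (x₀ : M) :
    chartMap I I' f x₀ (extChartAt I x₀ x₀) = extChartAt I' (f x₀) (f x₀) := by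
  unfold chartMap
  rw [(extChartAt I x₀).left_inv (mem_extChartAt_source x₀)]

lemma contDiffAt_chartMap {f : M → M'} {x₀ : M} (hf : ContMDiffAt I I' ∞ f x₀) :
    ContDiffAt ℝ ∞ (chartMap I I' f x₀) (extChartAt I x₀ x₀) := by
  rw [← contMDiffAt_iff_contDiffAt]
  have hx := (extChartAt I x₀).left_inv (mem_extChartAt_source x₀)
  refine ContMDiffAt.comp (I' := I) (f := (extChartAt I x₀).symm)
    (g := fun x => extChartAt I' (f x₀) (f x)) _ ?_
    (contMDiffAt_extChartAt_symm (mem_extChartAt_target x₀))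
  rw [hx]
  exact contMDiffAt_extChartAt.comp x₀ hf

/-- The chain rule in charts. -/
lemma diffAt_comp_frameAt {f : M → M'} {x₀ : M} {y : E} (hy : y ∈ (extChartAt I x₀).target)
    (hf : MDifferentiableAt I I' f ((extChartAt I x₀).symm y))
    (hfy : f ((extChartAt I x₀).symm y) ∈ (extChartAt I' (f x₀)).source) (v : E) :
    diffAt I I' f ((extChartAt I x₀).symm y) (frameAt I x₀ y v) =
      frameAt I' (f x₀) (chartMap I I' f x₀ y) (fderiv ℝ (chartMap I I' f x₀) y v) := by
  have h1 := mdifferentiableAt_extChartAt_symm (I := I) hy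
  have h2 := diffAt_eq_frameAt_comp_fderiv (f := fun y => f ((extChartAt I x₀).symm y))
    (x₀ := f x₀) (p := y) (hf.comp y h1) hfy
  rw [diffAt_comp hf h1, ← frameAt_eq_diffAt] at h2
  exact congrArg (fun L : E →L[ℝ] E' => L v) h2

/-- The points of the preferred chart at `x₀` where the chain rule holds. -/
lemma eventually_chart {f : M → M'} {x₀ : M} (hf : ContMDiffAt I I' ∞ f x₀) :
    ∀ᶠ y in 𝓝 (extChartAt I x₀ x₀), y ∈ (extChartAt I x₀).target ∧
      MDifferentiableAt I I' f ((extChartAt I x₀).symm y) ∧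
      f ((extChartAt I x₀).symm y) ∈ (extChartAt I' (f x₀)).source := by
  have hx := (extChartAt I x₀).left_inv (mem_extChartAt_source x₀)
  have hc : Filter.Tendsto (extChartAt I x₀).symm (𝓝 (extChartAt I x₀ x₀)) (𝓝 x₀) := by
    have := (contMDiffAt_extChartAt_symm (I := I) (mem_extChartAt_target x₀)).continuousAt
    rwa [ContinuousAt, hx] at this
  have h1 : ∀ᶠ x in 𝓝 x₀, MDifferentiableAt I I' f x := by
    filter_upwards [(contMDiffAt_iff_contMDiffAt_nhds (by simp)).1
      (hf.of_le (m := 1) (by simp))] with y hy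
    exact hy.mdifferentiableAt one_ne_zero
  have h2 : ∀ᶠ x in 𝓝 x₀, f x ∈ (extChartAt I' (f x₀)).source :=
    hf.continuousAt.preimage_mem_nhds ((isOpen_extChartAt_source _).mem_nhds
      (mem_extChartAt_source _))
  have h3 : ∀ᶠ y in 𝓝 (extChartAt I x₀ x₀), y ∈ (extChartAt I x₀).target :=
    (isOpen_extChartAt_target x₀).mem_nhds (mem_extChartAt_target x₀)
  exact h3.and ((hc.eventually h1).and (hc.eventually h2))

lemma tendsto_extChartAt_symm (x₀ : M) :
    Filter.Tendsto (extChartAt I x₀).symm (𝓝 (extChartAt I x₀ x₀)) (𝓝 x₀) := by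
  have := (contMDiffAt_extChartAt_symm (I := I) (mem_extChartAt_target x₀)).continuousAt
  rwa [ContinuousAt, (extChartAt I x₀).left_inv (mem_extChartAt_source x₀)] at this

lemma BilinField.contDiffAt_inChart_of_pullback [FiniteDimensional ℝ E] {f : M → M'} {x₀ : M}
    (hf : ContMDiffAt I I' ∞ f x₀) {g : BilinField I M} {g' : BilinField I' M'}
    (hg' : ContDiffAt ℝ ∞ (g'.inChart (f x₀)) (extChartAt I' (f x₀) (f x₀)))
    (h : ∀ᶠ x in 𝓝 x₀, ∀ u v : E,
      g.val x u v = g'.val (f x) (diffAt I I' f x u) (diffAt I I' f x v)) :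
    ContDiffAt ℝ ∞ (g.inChart x₀) (extChartAt I x₀ x₀) := by
  refine contDiffAt_bilin_of_apply fun u v => ?_
  have h1 := contDiffAt_chartMap hf
  have h2 : ContDiffAt ℝ ∞ (fderiv ℝ (chartMap I I' f x₀)) (extChartAt I x₀ x₀) :=
    h1.fderiv_right (by simp)
  rw [← chartMap_self (I := I)] at hg'
  have h3 : ContDiffAt ℝ ∞ (fun y => g'.inChart (f x₀) (chartMap I I' f x₀ y)
      (fderiv ℝ (chartMap I I' f x₀) y u) (fderiv ℝ (chartMap I I' f x₀) y v))
      (extChartAt I x₀ x₀) :=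
    ((hg'.comp _ h1).clm_apply (h2.clm_apply contDiffAt_const)).clm_apply
      (h2.clm_apply contDiffAt_const)
  refine h3.congr_of_eventuallyEq ?_
  filter_upwards [eventually_chart hf, (tendsto_extChartAt_symm x₀).eventually h] with y hy hgy
  unfold BilinField.inChart
  simp only [ContinuousLinearMap.bilinearComp_apply]
  rw [hgy, diffAt_comp_frameAt hy.1 hy.2.1 hy.2.2, diffAt_comp_frameAt hy.1 hy.2.1 hy.2.2]
  congr 2
  unfold chartMap
  rw [(extChartAt I' (f x₀)).left_inv hy.2.2]

lemma EndField.inChart_intertwines {f : M → M'} {x₀ : M}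
    {J : EndField I M} {J' : EndField I' M'} {y : E}
    (hy : y ∈ (extChartAt I x₀).target)
    (hf : MDifferentiableAt I I' f ((extChartAt I x₀).symm y))
    (hfy : f ((extChartAt I x₀).symm y) ∈ (extChartAt I' (f x₀)).source)
    (h : ∀ u : E, diffAt I I' f ((extChartAt I x₀).symm y) (J.val ((extChartAt I x₀).symm y) u) =
      J'.val (f ((extChartAt I x₀).symm y)) (diffAt I I' f ((extChartAt I x₀).symm y) u)) (u : E) :
    fderiv ℝ (chartMap I I' f x₀) y (J.inChart x₀ y u) =
      J'.inChart (f x₀) (chartMap I I' f x₀ y) (fderiv ℝ (chartMap I I' f x₀) y u) := by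
  have h4 : chartMap I I' f x₀ y ∈ (extChartAt I' (f x₀)).target :=
    (extChartAt I' (f x₀)).map_source hfy
  have h5 : (extChartAt I' (f x₀)).symm (chartMap I I' f x₀ y) = f ((extChartAt I x₀).symm y) :=
    (extChartAt I' (f x₀)).left_inv hfy
  have h6 := h (frameAt I x₀ y u)
  rw [diffAt_comp_frameAt hy hf hfy, ← frameAt_comp_coframeAt hy (J.val _ _),
    diffAt_comp_frameAt hy hf hfy] at h6
  have h7 := congrArg (coframeAt I' (f x₀) (f ((extChartAt I x₀).symm y))) h6
  rw [← h5, coframeAt_comp_frameAt h4] at h7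
  exact h7

lemma EndField.contDiffAt_inChart_of_intertwines [FiniteDimensional ℝ E] {f : M → M'} {x₀ : M}
    (hf : ContMDiffAt I I' ∞ f x₀) {J : EndField I M} {J' : EndField I' M'}
    (hJ' : ContDiffAt ℝ ∞ (J'.inChart (f x₀)) (extChartAt I' (f x₀) (f x₀)))
    (h : ∀ᶠ x in 𝓝 x₀, ∀ u : E, diffAt I I' f x (J.val x u) = J'.val (f x) (diffAt I I' f x u))
    (hinv : (diffAt I I' f x₀).IsInvertible) :
    ContDiffAt ℝ ∞ (J.inChart x₀) (extChartAt I x₀ x₀) := by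
  have : CompleteSpace E := FiniteDimensional.complete ℝ E
  have h1 := contDiffAt_chartMap hf
  have h2 : ContDiffAt ℝ ∞ (fderiv ℝ (chartMap I I' f x₀)) (extChartAt I x₀ x₀) :=
    h1.fderiv_right (by simp)
  have hx := (extChartAt I x₀).left_inv (mem_extChartAt_source x₀)
  have hD : fderiv ℝ (chartMap I I' f x₀) (extChartAt I x₀ x₀) = diffAt I I' f x₀ := by
    ext v
    have h3 := diffAt_comp_frameAt (f := f) (mem_extChartAt_target (I := I) x₀)
      (by rw [hx]; exact hf.mdifferentiableAt (by simp))
      (by rw [hx]; exact mem_extChartAt_source _) v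
    rw [chartMap_self (I := I), frameAt_self, frameAt_self, hx] at h3
    exact h3.symm
  obtain ⟨e, he⟩ := hinv
  have h4 : ContDiffAt ℝ ∞ (fun y => (fderiv ℝ (chartMap I I' f x₀) y).inverse)
      (extChartAt I x₀ x₀) := by
    have h5 := contDiffAt_map_inverse (𝕜 := ℝ) (n := ∞) e
    rw [he, ← hD] at h5
    exact h5.comp _ h2
  have hev : ∀ᶠ y in 𝓝 (extChartAt I x₀ x₀), ∃ e' : E ≃L[ℝ] E',
      (e' : E →L[ℝ] E') = fderiv ℝ (chartMap I I' f x₀) y := by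
    have h5 := ContinuousLinearEquiv.nhds e
    rw [he, ← hD] at h5
    filter_upwards [h2.continuousAt.preimage_mem_nhds h5] with y hy using hy
  rw [← chartMap_self (I := I)] at hJ'
  have h3 : ContDiffAt ℝ ∞ (fun y => (fderiv ℝ (chartMap I I' f x₀) y).inverse.comp
      ((J'.inChart (f x₀) (chartMap I I' f x₀ y)).comp (fderiv ℝ (chartMap I I' f x₀) y)))
      (extChartAt I x₀ x₀) :=
    h4.clm_comp ((hJ'.comp _ h1).clm_comp h2)
  refine h3.congr_of_eventuallyEq ?_
  filter_upwards [eventually_chart hf, (tendsto_extChartAt_symm x₀).eventually h, hev]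
    with y hy hJy ⟨e', he'⟩
  ext u
  have h8 := EndField.inChart_intertwines hy.1 hy.2.1 hy.2.2 hJy u
  simp only [ContinuousLinearMap.comp_apply]
  rw [← h8, ← he', ContinuousLinearMap.inverse_equiv]
  simp

/-- In charts, the pullback of forms is the one of normed spaces. -/
lemma FormField.inChart_pullback {k : ℕ} {α : FormField I' M' k} {f : M → M'} {x₀ : M} {y : E}
    (hy : y ∈ (extChartAt I x₀).target)
    (hf : MDifferentiableAt I I' f ((extChartAt I x₀).symm y))
    (hfy : f ((extChartAt I x₀).symm y) ∈ (extChartAt I' (f x₀)).source) :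
    (α.pullback (I := I) f).inChart x₀ y =
      (α.inChart (f x₀) (chartMap I I' f x₀ y)).compContinuousLinearMap
        (fderiv ℝ (chartMap I I' f x₀) y) := by
  ext v
  rw [ContinuousAlternatingMap.compContinuousLinearMap_apply, FormField.inChart_apply,
    FormField.inChart_apply, FormField.pullback_apply]
  simp only [diffAt_comp_frameAt hy hf hfy]
  unfold chartMap
  rw [(extChartAt I' (f x₀)).left_inv hfy]
  rfl

lemma FormField.IsDifferentiable.pullback {k : ℕ} {α : FormField I' M' k}
    (hα : α.IsDifferentiable) {f : M → M'} (hf : ContMDiff I I' ∞ f) :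
    (α.pullback (I := I) f).IsDifferentiable := by
  intro x₀
  have h1 := contDiffAt_chartMap hf.contMDiffAt (x₀ := x₀)
  have h2 : ContDiffAt ℝ ∞ (fderiv ℝ (chartMap I I' f x₀)) (extChartAt I x₀ x₀) :=
    h1.fderiv_right (by simp)
  have h0 := hα (f x₀)
  rw [← chartMap_self (I := I)] at h0
  have h3 : DifferentiableAt ℝ (fun y =>
      (α.inChart (f x₀) (chartMap I I' f x₀ y)).compContinuousLinearMap
        (fderiv ℝ (chartMap I I' f x₀) y)) (extChartAt I x₀ x₀) :=
    DifferentiableAt.continuousAlternatingMapCompContinuousLinearMap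
      (h0.comp _ (h1.differentiableAt (by simp))) (h2.differentiableAt (by simp))
  refine h3.congr_of_eventuallyEq ?_
  filter_upwards [eventually_chart hf.contMDiffAt] with y hy
  exact FormField.inChart_pullback hy.1 hy.2.1 hy.2.2

lemma FormField.d_add {k : ℕ} {α β : FormField I M k} (hα : α.IsDifferentiable)
    (hβ : β.IsDifferentiable) : FormField.d (α + β) = α.d + β.d := by
  refine FormField.ext_val fun x v => ?_
  refine (FormField.d_apply _ x v).trans ?_
  refine Eq.trans ?_ (congrArg₂ (· + ·) (FormField.d_apply α x v) (FormField.d_apply β x v)).symm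
  have : (α + β).inChart x = α.inChart x + β.inChart x := rfl
  rw [this, extDeriv_add (hα x) (hβ x)]
  rfl

end TensorPullback

/-! ### Hermitian structures: smoothness, pullback and products -/

section Hermitian

variable {E : Type*} [NormedAddCommGroup E] [NormedSpace ℝ E] [FiniteDimensional ℝ E]
  {H : Type*} [TopologicalSpace H] {I : ModelWithCorners ℝ E H}
  {M : Type*} [TopologicalSpace M] [ChartedSpace H M]
  {E' : Type*} [NormedAddCommGroup E'] [NormedSpace ℝ E'] [FiniteDimensional ℝ E']
  {H' : Type*} [TopologicalSpace H'] {I' : ModelWithCorners ℝ E' H'}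
  {M' : Type*} [TopologicalSpace M'] [ChartedSpace H' M']
  [I.Boundaryless] [I'.Boundaryless] [IsManifold I ∞ M] [IsManifold I' ∞ M']

lemma smoothMetric_contDiffAt (g : SmoothMetric I M) (x : M) :
    ContDiffAt ℝ ∞ (BilinField.inChart g.inner x) (extChartAt I x x) :=
  BilinField.contMDiffAt_iff.1 g.contMDiff.contMDiffAt

lemma IsComplexStructure.contDiffAt {J : EndField I M} (hJ : IsComplexStructure J) (x : M) :
    ContDiffAt ℝ ∞ (EndField.inChart J x) (extChartAt I x x) :=
  EndField.contMDiffAt_iff.1 hJ.smooth.contMDiffAt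

lemma Intertwines.val {f : M → M'} {J : EndField I M} {J' : EndField I' M'}
    (h : Intertwines f J J') (x : M) (u : E) :
    diffAt I I' f x (J.val x u) = J'.val (f x) (diffAt I I' f x u) := h x u

lemma PullsBackMetric.val {f : M → M'} {g : BilinField I M} {g' : BilinField I' M'}
    (h : PullsBackMetric f g g') (x : M) (u v : E) :
    g'.val (f x) (diffAt I I' f x u) (diffAt I I' f x v) = g.val x u v := h x u v

namespace HermitianStructure

/-- The metric, on the model space. -/
def gval (S : HermitianStructure I M) (x : M) : E →L[ℝ] E →L[ℝ] ℝ :=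
  BilinField.val S.metric.inner x

/-- The complex structure, on the model space. -/
def Jval (S : HermitianStructure I M) (x : M) : E →L[ℝ] E := EndField.val S.J x

lemma fundamentalForm_val (S : HermitianStructure I M) (x : M) (v : Fin 2 → E) :
    S.fundamentalForm.val x v = S.gval x (S.Jval x (v 0)) (v 1) := rfl

lemma dcOmega_val (S : HermitianStructure I M) (x : M) (v : Fin 3 → E) :
    S.dcOmega.val x v = -S.fundamentalForm.d.val x (fun i => S.Jval x (v i)) := rfl

lemma fundamentalForm_inChart (S : HermitianStructure I M) {x₀ : M} {y : E}
    (hy : y ∈ (extChartAt I x₀).target) (v : Fin 2 → E) :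
    S.fundamentalForm.inChart x₀ y v =
      BilinField.inChart S.metric.inner x₀ y (EndField.inChart S.J x₀ y (v 0)) (v 1) := by
  rw [FormField.inChart_apply, fundamentalForm_val]
  unfold BilinField.inChart EndField.inChart
  simp only [ContinuousLinearMap.bilinearComp_apply, ContinuousLinearMap.comp_apply]
  rw [frameAt_comp_coframeAt hy]
  rfl

lemma fundamentalForm_contDiffAt (S : HermitianStructure I M) (x : M) :
    ContDiffAt ℝ ∞ (S.fundamentalForm.inChart x) (extChartAt I x x) := by
  refine contDiffAt_alternating_of_apply fun v => ?_
  have h : ContDiffAt ℝ ∞ (fun y => BilinField.inChart S.metric.inner x y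
      (EndField.inChart S.J x y (v 0)) (v 1)) (extChartAt I x x) :=
    ((smoothMetric_contDiffAt S.metric x).clm_apply
      ((S.isComplex.contDiffAt x).clm_apply contDiffAt_const)).clm_apply contDiffAt_const
  refine h.congr_of_eventuallyEq ?_
  filter_upwards [(isOpen_extChartAt_target x).mem_nhds (mem_extChartAt_target (I := I) x)]
    with y hy
  exact S.fundamentalForm_inChart hy v

lemma fundamentalForm_isDifferentiable (S : HermitianStructure I M) :
    S.fundamentalForm.IsDifferentiable :=
  fun x => (S.fundamentalForm_contDiffAt x).differentiableAt (by simp)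

lemma dcOmega_isDifferentiable (S : HermitianStructure I M) : S.dcOmega.IsDifferentiable := by
  intro x
  have h1 : ContDiffAt ℝ ∞ (fderiv ℝ (S.fundamentalForm.inChart x)) (extChartAt I x x) :=
    (S.fundamentalForm_contDiffAt x).fderiv_right (by simp)
  have h2 : DifferentiableAt ℝ (extDeriv (S.fundamentalForm.inChart x)) (extChartAt I x x) :=
    (ContinuousAlternatingMap.alternatizeUncurryFinCLM ℝ E ℝ).differentiableAt.comp _
      (h1.differentiableAt (by simp))
  have h3 : DifferentiableAt ℝ (fun y => -(extDeriv (S.fundamentalForm.inChart x)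
      y).compContinuousLinearMap (EndField.inChart S.J x y)) (extChartAt I x x) :=
    (DifferentiableAt.continuousAlternatingMapCompContinuousLinearMap h2
      ((S.isComplex.contDiffAt x).differentiableAt (by simp))).neg
  refine h3.congr_of_eventuallyEq ?_
  filter_upwards [(isOpen_extChartAt_target x).mem_nhds (mem_extChartAt_target (I := I) x)]
    with y hy
  ext v
  rw [FormField.inChart_apply, dcOmega_val,
    ← FormField.inChart_d S.fundamentalForm_isDifferentiable hy]
  simp only [ContinuousAlternatingMap.neg_apply,
    ContinuousAlternatingMap.compContinuousLinearMap_apply]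
  rw [FormField.inChart_apply]
  congr 2
  ext i
  exact (frameAt_comp_coframeAt hy _).symm

/-- The fundamental form is natural under holomorphic maps that pull back the metric. -/
lemma fundamentalForm_eq_pullback {S : HermitianStructure I M} {T : HermitianStructure I' M'}
    {f : M → M'} (hg : PullsBackMetric f S.metric.inner T.metric.inner)
    (hJ : Intertwines f S.J T.J) :
    S.fundamentalForm = T.fundamentalForm.pullback f := by
  refine FormField.ext_val fun x v => ?_
  rw [FormField.pullback_apply, fundamentalForm_val, fundamentalForm_val]
  have h := hg.val x (S.Jval x (v 0)) (v 1)
  rw [Jval, hJ.val] at h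
  exact h.symm

lemma dcOmega_eq_pullback_of_d {S : HermitianStructure I M} {T : HermitianStructure I' M'}
    {f : M → M'} (hd : S.fundamentalForm.d = T.fundamentalForm.d.pullback f)
    (hJ : Intertwines f S.J T.J) : S.dcOmega = T.dcOmega.pullback f := by
  refine FormField.ext_val fun x v => ?_
  rw [FormField.pullback_apply, dcOmega_val, dcOmega_val, hd, FormField.pullback_apply]
  congr 2
  ext i
  exact hJ x (v i)

lemma dcOmega_eq_pullback {S : HermitianStructure I M} {T : HermitianStructure I' M'}
    {f : M → M'} (hf : ContMDiff I I' ∞ f)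
    (hg : PullsBackMetric f S.metric.inner T.metric.inner)
    (hJ : Intertwines f S.J T.J) : S.dcOmega = T.dcOmega.pullback f := by
  refine dcOmega_eq_pullback_of_d ?_ hJ
  rw [fundamentalForm_eq_pullback hg hJ,
    FormField.d_pullback T.fundamentalForm_isDifferentiable hf]

end HermitianStructure

/-- In finite dimension the unit ball of a positive definite form is bounded. -/
lemma isVonNBounded_of_pos (B : E →L[ℝ] E →L[ℝ] ℝ) (hB : ∀ v, v ≠ 0 → 0 < B v v) :
    Bornology.IsVonNBounded ℝ {v : E | B v v < 1} := by
  rw [NormedSpace.isVonNBounded_iff]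
  have hcont : Continuous fun v : E => B v v := by fun_prop
  have : ProperSpace E := FiniteDimensional.proper ℝ E
  rcases (Metric.sphere (0 : E) 1).eq_empty_or_nonempty with h | h
  · have h0 : ∀ v : E, v = 0 := by
      intro v
      by_contra hv
      have : (‖v‖⁻¹ • v) ∈ Metric.sphere (0 : E) 1 := by simp [norm_smul, hv]
      rw [h] at this
      exact this
    exact (Bornology.isBounded_singleton (x := (0 : E))).subset fun v _ => h0 v
  · obtain ⟨w, hw, hmin⟩ := (isCompact_sphere (0 : E) 1).exists_isMinOn h hcont.continuousOn
    have hw0 : w ≠ 0 := by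
      rintro rfl
      simp at hw
    have hc := hB w hw0
    rw [isBounded_iff_forall_norm_le]
    refine ⟨Real.sqrt ((B w w)⁻¹), fun v hv => ?_⟩
    by_cases hv0 : v = 0
    · simp [hv0]
    have h1 : B w w ≤ B (‖v‖⁻¹ • v) (‖v‖⁻¹ • v) :=
      hmin (by simp [norm_smul, hv0] : (‖v‖⁻¹ • v) ∈ Metric.sphere (0 : E) 1)
    have hn : 0 < ‖v‖ := norm_pos_iff.2 hv0
    simp only [map_smul, smul_apply, smul_eq_mul] at h1
    have hv1 : B v v < 1 := hv
    apply Real.le_sqrt_of_sq_le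
    rw [← one_div, le_div_iff₀ hc]
    have h2 : ‖v‖ ^ 2 * B w w ≤ ‖v‖ ^ 2 * (‖v‖⁻¹ * (‖v‖⁻¹ * B v v)) :=
      mul_le_mul_of_nonneg_left h1 (by positivity)
    have h3 : ‖v‖ ^ 2 * (‖v‖⁻¹ * (‖v‖⁻¹ * B v v)) = B v v := by field_simp
    linarith

lemma diffAt_fst (x : M × M') : diffAt (I.prod I') I Prod.fst x = ContinuousLinearMap.fst ℝ E E' :=
  mfderiv_fst

lemma diffAt_snd (x : M × M') :
    diffAt (I.prod I') I' Prod.snd x = ContinuousLinearMap.snd ℝ E E' :=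
  mfderiv_snd

lemma prodBilin_val (g : BilinField I M) (g' : BilinField I' M') (x : M × M') (u v : E × E') :
    (prodBilin g g').val x u v = g.val x.1 u.1 v.1 + g'.val x.2 u.2 v.2 := rfl

lemma prodEnd_val (J : EndField I M) (J' : EndField I' M') (x : M × M') (u : E × E') :
    (prodEnd J J').val x u = (J.val x.1 u.1, J'.val x.2 u.2) := rfl

lemma prodBilin_contDiffAt {g : BilinField I M} {g' : BilinField I' M'} {x : M × M'}
    (hg : ContDiffAt ℝ ∞ (g.inChart x.1) (extChartAt I x.1 x.1))
    (hg' : ContDiffAt ℝ ∞ (g'.inChart x.2) (extChartAt I' x.2 x.2)) :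
    ContDiffAt ℝ ∞ ((prodBilin g g').inChart x) (extChartAt (I.prod I') x x) := by
  let g₁ : BilinField (I.prod I') (M × M') := fun z =>
    (g.val z.1).bilinearComp (ContinuousLinearMap.fst ℝ E E') (ContinuousLinearMap.fst ℝ E E')
  let g₂ : BilinField (I.prod I') (M × M') := fun z =>
    (g'.val z.2).bilinearComp (ContinuousLinearMap.snd ℝ E E') (ContinuousLinearMap.snd ℝ E E')
  have h1 : ContDiffAt ℝ ∞ (g₁.inChart x) (extChartAt (I.prod I') x x) := by
    refine BilinField.contDiffAt_inChart_of_pullback (f := Prod.fst) contMDiffAt_fst hg ?_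
    refine Filter.Eventually.of_forall fun z u v => ?_
    rw [diffAt_fst]; rfl
  have h2 : ContDiffAt ℝ ∞ (g₂.inChart x) (extChartAt (I.prod I') x x) := by
    refine BilinField.contDiffAt_inChart_of_pullback (f := Prod.snd) contMDiffAt_snd hg' ?_
    refine Filter.Eventually.of_forall fun z u v => ?_
    rw [diffAt_snd]; rfl
  exact h1.add h2

lemma chartMap_fst_eventuallyEq {x : M × M'} {y : E × E'}
    (hy : y ∈ (extChartAt (I.prod I') x).target) :
    chartMap (I.prod I') I Prod.fst x =ᶠ[𝓝 y] Prod.fst := by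
  filter_upwards [(isOpen_extChartAt_target x).mem_nhds hy] with z hz
  rw [extChartAt_prod] at hz
  unfold chartMap
  rw [extChartAt_prod]
  exact (extChartAt I x.1).right_inv hz.1

lemma chartMap_snd_eventuallyEq {x : M × M'} {y : E × E'}
    (hy : y ∈ (extChartAt (I.prod I') x).target) :
    chartMap (I.prod I') I' Prod.snd x =ᶠ[𝓝 y] Prod.snd := by
  filter_upwards [(isOpen_extChartAt_target x).mem_nhds hy] with z hz
  rw [extChartAt_prod] at hz
  unfold chartMap
  rw [extChartAt_prod]
  exact (extChartAt I' x.2).right_inv hz.2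

lemma prodEnd_inChart {J : EndField I M} {J' : EndField I' M'} {x : M × M'} {y : E × E'}
    (hy : y ∈ (extChartAt (I.prod I') x).target) (u : E × E') :
    (prodEnd J J').inChart x y u = (J.inChart x.1 y.1 u.1, J'.inChart x.2 y.2 u.2) := by
  have hy' := hy
  rw [extChartAt_prod] at hy'
  have h1 := EndField.inChart_intertwines (f := (Prod.fst : M × M' → M)) (J := prodEnd J J')
    (J' := J) hy mdifferentiableAt_fst
    (by rw [extChartAt_prod]; exact (extChartAt I x.1).map_target hy'.1)
    (fun u => by rw [diffAt_fst]; rfl) u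
  have h2 := EndField.inChart_intertwines (f := (Prod.snd : M × M' → M')) (J := prodEnd J J')
    (J' := J') hy mdifferentiableAt_snd
    (by rw [extChartAt_prod]; exact (extChartAt I' x.2).map_target hy'.2)
    (fun u => by rw [diffAt_snd]; rfl) u
  rw [(chartMap_fst_eventuallyEq hy).fderiv_eq, fderiv_fst,
    (chartMap_fst_eventuallyEq hy).eq_of_nhds] at h1
  rw [(chartMap_snd_eventuallyEq hy).fderiv_eq, fderiv_snd,
    (chartMap_snd_eventuallyEq hy).eq_of_nhds] at h2
  exact Prod.ext h1 h2

lemma prodEnd_contDiffAt {J : EndField I M} {J' : EndField I' M'} {x : M × M'}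
    (hJ : ContDiffAt ℝ ∞ (J.inChart x.1) (extChartAt I x.1 x.1))
    (hJ' : ContDiffAt ℝ ∞ (J'.inChart x.2) (extChartAt I' x.2 x.2)) :
    ContDiffAt ℝ ∞ ((prodEnd J J').inChart x) (extChartAt (I.prod I') x x) := by
  refine contDiffAt_clm_of_apply fun u => ?_
  have h : ContDiffAt ℝ ∞ (fun y : E × E' =>
      (J.inChart x.1 y.1 u.1, J'.inChart x.2 y.2 u.2)) (extChartAt (I.prod I') x x) := by
    rw [extChartAt_prod]
    refine ContDiffAt.prodMk ?_ ?_
    · exact (ContDiffAt.comp (extChartAt I x.1 x.1, extChartAt I' x.2 x.2) hJ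
        contDiffAt_fst).clm_apply contDiffAt_const
    · exact (ContDiffAt.comp (extChartAt I x.1 x.1, extChartAt I' x.2 x.2) hJ'
        contDiffAt_snd).clm_apply contDiffAt_const
  refine h.congr_of_eventuallyEq ?_
  filter_upwards [(isOpen_extChartAt_target x).mem_nhds (mem_extChartAt_target (I := I.prod I') x)]
    with y hy
  exact prodEnd_inChart hy u

lemma prodBilin_pos (g : SmoothMetric I M) (g' : SmoothMetric I' M') (x : M × M') (v : E × E')
    (hv : v ≠ 0) : 0 < (prodBilin g.inner g'.inner).val x v v := by
  rw [prodBilin_val]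
  have h1 : ∀ w : E, 0 ≤ BilinField.val g.inner x.1 w w := fun w => by
    by_cases hw : w = 0
    · simp [hw]
    · exact (g.pos x.1 w hw).le
  have h2 : ∀ w : E', 0 ≤ BilinField.val g'.inner x.2 w w := fun w => by
    by_cases hw : w = 0
    · simp [hw]
    · exact (g'.pos x.2 w hw).le
  by_cases hv1 : v.1 = 0
  · have hv2 : v.2 ≠ 0 := fun h => hv (Prod.ext hv1 h)
    have h3 : 0 < BilinField.val g'.inner x.2 v.2 v.2 := g'.pos x.2 v.2 hv2
    have := h1 v.1
    linarith
  · have h3 : 0 < BilinField.val g.inner x.1 v.1 v.1 := g.pos x.1 v.1 hv1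
    have := h2 v.2
    linarith

/-- The product of two smooth metrics. -/
def prodMetric (g : SmoothMetric I M) (g' : SmoothMetric I' M') :
    SmoothMetric (I.prod I') (M × M') where
  inner := prodBilin g.inner g'.inner
  symm x u v := congrArg₂ (· + ·) (g.symm x.1 (u : E × E').1 (v : E × E').1)
    (g'.symm x.2 (u : E × E').2 (v : E × E').2)
  pos x v hv := prodBilin_pos g g' x v hv
  isVonNBounded x := isVonNBounded_of_pos (E := E × E') ((prodBilin g.inner g'.inner).val x)
    (prodBilin_pos g g' x)
  contMDiff x := BilinField.contMDiffAt_iff.2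
    (prodBilin_contDiffAt (smoothMetric_contDiffAt g x.1) (smoothMetric_contDiffAt g' x.2))

/-- The product of two partial diffeomorphisms with values in `ℂ^r` and `ℂ^s`. -/
def PartialDiffeomorph.prodAppend {r s : ℕ}
    (φ : PartialDiffeomorph I 𝓘(ℝ, Fin r → ℂ) M (Fin r → ℂ) ∞)
    (φ' : PartialDiffeomorph I' 𝓘(ℝ, Fin s → ℂ) M' (Fin s → ℂ) ∞) :
    PartialDiffeomorph (I.prod I') 𝓘(ℝ, Fin (r + s) → ℂ) (M × M') (Fin (r + s) → ℂ) ∞ where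
  toFun x := Fin.append (φ x.1) (φ' x.2)
  invFun z := (φ.symm fun i => z (Fin.castAdd s i), φ'.symm fun i => z (Fin.natAdd r i))
  source := φ.source ×ˢ φ'.source
  target := (fun z i => z (Fin.castAdd s i)) ⁻¹' φ.target ∩
    (fun z i => z (Fin.natAdd r i)) ⁻¹' φ'.target
  map_source' x hx := by
    refine ⟨?_, ?_⟩
    · simpa using φ.map_source hx.1
    · simpa using φ'.map_source hx.2
  map_target' z hz := ⟨φ.map_target hz.1, φ'.map_target hz.2⟩
  left_inv' x hx := by
    refine Prod.ext ?_ ?_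
    · simpa using φ.left_inv hx.1
    · simpa using φ'.left_inv hx.2
  right_inv' z hz := by
    have h1 := φ.right_inv hz.1
    have h2 := φ'.right_inv hz.2
    ext i
    refine Fin.addCases (fun j => ?_) (fun j => ?_) i
    · rw [Fin.append_left]; exact congrFun h1 j
    · rw [Fin.append_right]; exact congrFun h2 j
  open_source := φ.open_source.prod φ'.open_source
  open_target := (φ.open_target.preimage (by fun_prop)).inter
    (φ'.open_target.preimage (by fun_prop))
  contMDiffOn_toFun := by
    rw [contMDiffOn_pi_space]
    intro i
    refine Fin.addCases (fun j => ?_) (fun j => ?_) i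
    · simp only [Fin.append_left]
      exact (contMDiffOn_pi_space.1 φ.contMDiffOn j).comp contMDiffOn_fst fun x hx => hx.1
    · simp only [Fin.append_right]
      exact (contMDiffOn_pi_space.1 φ'.contMDiffOn j).comp contMDiffOn_snd fun x hx => hx.2
  contMDiffOn_invFun := by
    refine ContMDiffOn.prodMk ?_ ?_
    · refine φ.symm.contMDiffOn.comp (ContMDiff.contMDiffOn ?_) fun x hx => hx.1
      exact contMDiff_iff_contDiff.2 (by fun_prop)
    · refine φ'.symm.contMDiffOn.comp (ContMDiff.contMDiffOn ?_) fun x hx => hx.2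
      exact contMDiff_iff_contDiff.2 (by fun_prop)

lemma MDifferentiableAt.pi_apply {ι : Type*} [Fintype ι] {f : M → ι → ℂ} {x : M}
    (hf : MDifferentiableAt I 𝓘(ℝ, ι → ℂ) f x) (j : ι) :
    MDifferentiableAt I 𝓘(ℝ, ℂ) (fun z => f z j) x :=
  (ContinuousLinearMap.proj (R := ℝ) (φ := fun _ : ι => ℂ) j).mdifferentiableAt.comp x hf

lemma diffAt_pi_apply {ι : Type*} [Fintype ι] {f : M → ι → ℂ} {x : M}
    (hf : MDifferentiableAt I 𝓘(ℝ, ι → ℂ) f x) (u : E) (j : ι) :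
    diffAt I 𝓘(ℝ, ι → ℂ) f x u j = diffAt I 𝓘(ℝ, ℂ) (fun z => f z j) x u := by
  have h := diffAt_comp (I := I) (I' := 𝓘(ℝ, ι → ℂ)) (I'' := 𝓘(ℝ, ℂ)) (x := x)
    (g := fun w : ι → ℂ => w j) (f := f)
    (ContinuousLinearMap.proj (R := ℝ) (φ := fun _ : ι => ℂ) j).mdifferentiableAt hf
  rw [h]
  have h2 : diffAt 𝓘(ℝ, ι → ℂ) 𝓘(ℝ, ℂ) (fun w : ι → ℂ => w j) (f x) =
      ContinuousLinearMap.proj (R := ℝ) (φ := fun _ : ι => ℂ) j :=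
    (ContinuousLinearMap.proj (R := ℝ) (φ := fun _ : ι => ℂ) j).mfderiv_eq
  rw [h2]; rfl

lemma IsComplexStructure.prodEnd {J : EndField I M} {J' : EndField I' M'}
    (hJ : IsComplexStructure J) (hJ' : IsComplexStructure J') :
    IsComplexStructure (prodEnd J J') where
  smooth x := EndField.contMDiffAt_iff.2
    (prodEnd_contDiffAt (hJ.contDiffAt x.1) (hJ'.contDiffAt x.2))
  sq x u := Prod.ext (hJ.sq x.1 (u : E × E').1) (hJ'.sq x.2 (u : E × E').2)
  integrable x := by
    obtain ⟨r, φ, hx, hφ⟩ := hJ.integrable x.1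
    obtain ⟨s, φ', hx', hφ'⟩ := hJ'.integrable x.2
    refine ⟨r + s, φ.prodAppend φ', ⟨hx, hx'⟩, ?_⟩
    rintro y ⟨hy, hy'⟩ u j
    have hm : ∀ (w : E × E'), diffAt (I.prod I') 𝓘(ℝ, Fin (r + s) → ℂ) (φ.prodAppend φ') y w =
        Fin.append (diffAt I 𝓘(ℝ, Fin r → ℂ) φ y.1 w.1)
          (diffAt I' 𝓘(ℝ, Fin s → ℂ) φ' y.2 w.2) := by
      intro w
      have hd := (φ.prodAppend φ').mdifferentiableAt (by simp) (x := y) ⟨hy, hy'⟩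
      have hd1 := φ.mdifferentiableAt (by simp) hy
      have hd2 := φ'.mdifferentiableAt (by simp) hy'
      ext i
      rw [diffAt_pi_apply hd]
      refine Fin.addCases (fun j => ?_) (fun j => ?_) i
      · rw [Fin.append_left, diffAt_pi_apply hd1]
        have : (fun z => φ.prodAppend φ' z (Fin.castAdd s j)) = fun z : M × M' => φ z.1 j :=
          funext fun z => Fin.append_left _ _ j
        rw [this, diffAt_comp (g := fun z => φ z j) (f := Prod.fst)
          (hd1.pi_apply j) mdifferentiableAt_fst, diffAt_fst]
        rfl
      · rw [Fin.append_right, diffAt_pi_apply hd2]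
        have : (fun z => φ.prodAppend φ' z (Fin.natAdd r j)) = fun z : M × M' => φ' z.2 j :=
          funext fun z => Fin.append_right _ _ j
        rw [this, diffAt_comp (g := fun z => φ' z j) (f := Prod.snd)
          (hd2.pi_apply j) mdifferentiableAt_snd, diffAt_snd]
        rfl
    refine (congrFun (hm _) j).trans (Eq.trans ?_ (congrArg (Complex.I * ·)
      (congrFun (hm u) j)).symm)
    refine Fin.addCases (fun j => ?_) (fun j => ?_) j
    · simp only [Fin.append_left]
      exact hφ y.1 hy (u : E × E').1 j
    · simp only [Fin.append_right]
      exact hφ' y.2 hy' (u : E × E').2 j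

/-- The product of two Hermitian structures. -/
def HermitianStructure.prod (S : HermitianStructure I M) (T : HermitianStructure I' M') :
    HermitianStructure (I.prod I') (M × M') where
  metric := prodMetric S.metric T.metric
  J := prodEnd S.J T.J
  isComplex := S.isComplex.prodEnd T.isComplex
  compatible x u v := congrArg₂ (· + ·) (S.compatible x.1 (u : E × E').1 (v : E × E').1)
    (T.compatible x.2 (u : E × E').2 (v : E × E').2)

lemma HermitianStructure.prod_dcOmega_of_isKahler {S : HermitianStructure I M}
    (T : HermitianStructure I' M') (hS : S.IsKahler) :
    (S.prod T).dcOmega = T.dcOmega.pullback Prod.snd := by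
  refine dcOmega_eq_pullback_of_d ?_ fun x u => ?_
  · have h1 : (S.prod T).fundamentalForm =
        S.fundamentalForm.pullback Prod.fst + T.fundamentalForm.pullback Prod.snd := by
      refine FormField.ext_val fun x v => ?_
      change _ = (S.fundamentalForm.pullback (I := I.prod I') (M := M × M') Prod.fst).val x v +
        (T.fundamentalForm.pullback (I := I.prod I') (M := M × M') Prod.snd).val x v
      rw [FormField.pullback_apply, FormField.pullback_apply, diffAt_fst, diffAt_snd]
      rfl
    rw [h1, FormField.d_add (S.fundamentalForm_isDifferentiable.pullback contMDiff_fst)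
      (T.fundamentalForm_isDifferentiable.pullback contMDiff_snd),
      FormField.d_pullback S.fundamentalForm_isDifferentiable contMDiff_fst,
      FormField.d_pullback T.fundamentalForm_isDifferentiable contMDiff_snd, hS]
    have h2 : (0 : FormField I M 3).pullback (I := I.prod I') (Prod.fst : M × M' → M) = 0 := rfl
    rw [h2, zero_add]
  · have h : ∀ w, diffAt (I.prod I') I' (Prod.snd : M × M' → M') x w =
        ContinuousLinearMap.snd ℝ E E' w := fun w => by rw [diffAt_snd]
    exact (h _).trans (congrArg (T.J.val x.2) (h u)).symm

end Hermitian

/-! ### Quotients of manifolds by deck transformations -/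

section QuotientManifold

variable {E : Type*} [NormedAddCommGroup E] [NormedSpace ℝ E]
  {H : Type*} [TopologicalSpace H] {I : ModelWithCorners ℝ E H}
  {X : Type*} [TopologicalSpace X] [ChartedSpace H X] [I.Boundaryless] [IsManifold I ∞ X]
  {M : Type*} [TopologicalSpace M]

/-- A local inverse of `pr`, composed with `pr`, is locally a deck transformation. -/
lemma IsLocalHomeomorph.localInverseAt_comp_eventuallyEq {pr : X → M} (hπ : IsLocalHomeomorph pr)
    {a x : X} {τ : X → X} (hτ : Continuous τ) (hπτ : ∀ z, pr (τ z) = pr z)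
    (hx : τ x ∈ (hπ.localInverseAt a).target) :
    (fun z => hπ.localInverseAt a (pr z)) =ᶠ[𝓝 x] τ := by
  filter_upwards [hτ.continuousAt.preimage_mem_nhds
    ((hπ.localInverseAt a).open_target.mem_nhds hx)] with z hz
  rw [← hπτ z, ← congrFun (hπ.localInverseAt_symm a) (τ z)]
  exact (hπ.localInverseAt a).right_inv hz

/-- The quotient of a smooth manifold by smooth deck transformations is a smooth manifold. -/
theorem exists_isManifold_quotient {pr : X → M} (hπ : IsLocalHomeomorph pr)
    (hs : Function.Surjective pr)
    (hdeck : ∀ x y, pr x = pr y → ∃ τ : X → X, ContMDiff I I ∞ τ ∧ τ x = y ∧ ∀ z, pr (τ z) = pr z) :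
    ∃ (_ : ChartedSpace H M) (_ : IsManifold I ∞ M), IsLocalDiffeomorph I I ∞ pr := by
  obtain ⟨g, hg⟩ := hs.hasRightInverse
  let cs : ChartedSpace H M := hπ.chartedSpaceOfRightInverse hg
  have hchart : ∀ q : M, extChartAt I q =
      ((hπ.localInverseAt (g q)).trans (chartAt H (g q))).extend I := fun q => rfl
  have hmf : IsManifold I ∞ M := by
    refine isManifold_of_contDiffOn I ∞ M ?_
    rintro _ _ ⟨q, rfl⟩ ⟨q', rfl⟩ z ⟨hz, -⟩
    apply ContDiffAt.contDiffWithinAt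
    simp only [OpenPartialHomeomorph.trans_symm_eq_symm_trans_symm,
      OpenPartialHomeomorph.trans_source, OpenPartialHomeomorph.symm_source,
      OpenPartialHomeomorph.coe_trans,
      Set.mem_preimage, Set.mem_inter_iff, Function.comp_apply,
      IsLocalHomeomorph.localInverseAt_symm] at hz
    obtain ⟨⟨hz1, hz2⟩, hz3, hz4⟩ := hz
    set w := (chartAt H (g q)).symm (I.symm z) with hw
    obtain ⟨τ, hτ, hτw, hπτ⟩ := hdeck w (hπ.localInverseAt (g q') (pr w))
      (hπ.apply_localInverseAt_of_mem hz3).symm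
    have hev := hπ.localInverseAt_comp_eventuallyEq (a := g q') (x := w) hτ.continuous hπτ
      (by rw [hτw]; exact (hπ.localInverseAt (g q')).map_source hz3)
    have hzt : z ∈ (extChartAt I (g q)).target := by
      rw [extChartAt_target]
      exact ⟨hz1, by simp [I.range_eq_univ]⟩
    have hsymm := contMDiffAt_extChartAt_symm (I := I) hzt
    have h1 : ContMDiffAt 𝓘(ℝ, E) 𝓘(ℝ, E) ∞
        (fun y => extChartAt I (g q') (τ ((extChartAt I (g q)).symm y))) z := by
      refine ContMDiffAt.comp (I' := I) (g := extChartAt I (g q'))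
        (f := fun y => τ ((extChartAt I (g q)).symm y)) z ?_ (hτ.contMDiffAt.comp z hsymm)
      refine contMDiffAt_extChartAt' ?_
      change τ w ∈ _
      rw [hτw]
      exact hz4
    refine (contMDiffAt_iff_contDiffAt.1 h1).congr_of_eventuallyEq ?_
    filter_upwards [hsymm.continuousAt.eventually hev] with y hy
    simp only [OpenPartialHomeomorph.trans_symm_eq_symm_trans_symm,
      OpenPartialHomeomorph.coe_trans, Function.comp_apply,
      IsLocalHomeomorph.localInverseAt_symm]
    rw [← hy]
    rfl
  have hsmooth : ContMDiff I I ∞ pr := by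
    intro x
    obtain ⟨τ, hτ, hτx, hπτ⟩ := hdeck x (g (pr x)) (hg (pr x)).symm
    have hev := hπ.localInverseAt_comp_eventuallyEq (a := g (pr x)) (x := x) hτ.continuous hπτ
      (by rw [hτx]; exact hπ.self_mem_localInverseAt_target)
    refine contMDiffAt_iff_target.2 ⟨hπ.continuous.continuousAt, ?_⟩
    have h1 : ContMDiffAt I 𝓘(ℝ, E) ∞ (fun z => extChartAt I (g (pr x)) (τ z)) x :=
      ContMDiffAt.comp (I' := I) (g := extChartAt I (g (pr x))) x
        (contMDiffAt_extChartAt' (by rw [hτx]; exact mem_chart_source H _)) hτ.contMDiffAt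
    refine h1.congr_of_eventuallyEq ?_
    filter_upwards [hev] with z hz
    rw [← hz]
    rfl
  have hinv : ∀ x : X, ∀ y ∈ (hπ.localInverseAt x).source,
      ContMDiffAt I I ∞ (hπ.localInverseAt x) y := by
    intro x y hy
    have hgy : y ∈ (hπ.localInverseAt (g y)).source := by
      have := hπ.apply_self_mem_localInverseAt_source (x := g y)
      rwa [hg y] at this
    have hgy' : hπ.localInverseAt (g y) y = g y := by
      have := hπ.localInverseAt_apply_self (x := g y)
      rwa [hg y] at this
    obtain ⟨τ, hτ, hτx, hπτ⟩ := hdeck (g y) (hπ.localInverseAt x y)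
      ((hg y).trans (hπ.apply_localInverseAt_of_mem hy).symm)
    have hev := hπ.localInverseAt_comp_eventuallyEq (a := x) (x := g y) hτ.continuous hπτ
      (by rw [hτx]; exact (hπ.localInverseAt x).map_source hy)
    have h1 : ContMDiffAt I I ∞ (fun w => (extChartAt I (g y)).symm (extChartAt I y w)) y := by
      refine ContMDiffAt.comp (I' := 𝓘(ℝ, E)) (g := (extChartAt I (g y)).symm) y ?_
        contMDiffAt_extChartAt
      refine contMDiffAt_extChartAt_symm ?_
      have : extChartAt I y y = extChartAt I (g y) (hπ.localInverseAt (g y) y) := rfl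
      rw [this, hgy']
      exact mem_extChartAt_target _
    have h2 : (fun w => (extChartAt I (g y)).symm (extChartAt I y w)) =ᶠ[𝓝 y]
        hπ.localInverseAt (g y) := by
      have hc := (hπ.localInverseAt (g y)).continuousAt hgy
      filter_upwards [hc.preimage_mem_nhds ((isOpen_extChartAt_source (I := I) (g y)).mem_nhds
        (by rw [hgy']; exact mem_extChartAt_source _))] with w hw
      exact (extChartAt I (g y)).left_inv hw
    have h3 : ContMDiffAt I I ∞ (fun w => τ (hπ.localInverseAt (g y) w)) y :=
      hτ.contMDiffAt.comp y (h1.congr_of_eventuallyEq h2.symm)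
    refine h3.congr_of_eventuallyEq ?_
    have hc := (hπ.localInverseAt (g y)).continuousAt hgy
    rw [ContinuousAt, hgy'] at hc
    filter_upwards [hc.eventually hev, (hπ.localInverseAt (g y)).open_source.mem_nhds hgy]
      with w hw hw'
    rw [← hw, hπ.apply_localInverseAt_of_mem hw']
  refine ⟨cs, hmf, fun x => ⟨{
    toPartialEquiv := (hπ.localInverseAt x).symm.toPartialEquiv
    open_source := (hπ.localInverseAt x).open_target
    open_target := (hπ.localInverseAt x).open_source
    contMDiffOn_toFun := ?_
    contMDiffOn_invFun := fun y hy => (hinv x y hy).contMDiffWithinAt }, ?_, ?_⟩⟩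
  · have : ((hπ.localInverseAt x).symm : X → M) = pr := hπ.localInverseAt_symm x
    change ContMDiffOn I I ∞ ((hπ.localInverseAt x).symm : X → M) _
    rw [this]
    exact hsmooth.contMDiffOn
  · exact hπ.self_mem_localInverseAt_target
  · intro z _
    exact (congrFun (hπ.localInverseAt_symm x) z).symm

end QuotientManifold

section Descend

variable {E : Type*} [NormedAddCommGroup E] [NormedSpace ℝ E] [FiniteDimensional ℝ E]
  {H : Type*} [TopologicalSpace H] {I : ModelWithCorners ℝ E H} [I.Boundaryless]
  {X : Type*} [TopologicalSpace X] [ChartedSpace H X] [IsManifold I ∞ X]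
  {M : Type*} [TopologicalSpace M] [ChartedSpace H M] [IsManifold I ∞ M] {pr : X → M}

/-- The inverse of the differential of a local diffeomorphism. -/
def IsLocalDiffeomorph.diffInv (hπ : IsLocalDiffeomorph I I ∞ pr) (x : X) : E →L[ℝ] E :=
  ((hπ x).mfderivToContinuousLinearEquiv (by simp)).symm.toContinuousLinearMap

namespace IsLocalDiffeomorph

variable (hπ : IsLocalDiffeomorph I I ∞ pr)

lemma diffInv_diffAt (x : X) (v : E) : hπ.diffInv x (diffAt I I pr x v) = v :=
  ((hπ x).mfderivToContinuousLinearEquiv (by simp)).symm_apply_apply v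

lemma diffAt_diffInv (x : X) (v : E) : diffAt I I pr x (hπ.diffInv x v) = v :=
  ((hπ x).mfderivToContinuousLinearEquiv (by simp)).apply_symm_apply v

lemma localInverse_mdifferentiableAt_of_mem {x : X} {z : M} (hz : z ∈ (hπ x).localInverse.source) :
    MDifferentiableAt I I (hπ x).localInverse z :=
  (hπ x).localInverse.mdifferentiableAt (by simp) hz

lemma diffAt_diffAt_localInverse {x : X} {z : M} (hz : z ∈ (hπ x).localInverse.source) (v : E) :
    diffAt I I pr ((hπ x).localInverse z) (diffAt I I (hπ x).localInverse z v) = v := by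
  have h1 : (fun w => pr ((hπ x).localInverse w)) =ᶠ[𝓝 z] fun w => w := by
    filter_upwards [(hπ x).localInverse.open_source.mem_nhds hz] with w hw
    exact (hπ x).localInverse_right_inv hw
  have h2 := diffAt_congr (I := I) (I' := I) h1
  rw [diffAt_id, diffAt_comp (hπ.mdifferentiable (by simp) _)
    (hπ.localInverse_mdifferentiableAt_of_mem hz)] at h2
  exact congrArg (fun L : E →L[ℝ] E => L v) h2

end IsLocalDiffeomorph

lemma diffAt_deck {τ : X → X} (hπ : ContMDiff I I ∞ pr) (hτ : ContMDiff I I ∞ τ)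
    (h : ∀ z, pr (τ z) = pr z) (x : X) (v : E) :
    diffAt I I pr (τ x) (diffAt I I τ x v) = diffAt I I pr x v := by
  have h1 : (fun z => pr (τ z)) = pr := funext h
  have h2 := diffAt_comp (hπ.mdifferentiable (by simp) (τ x)) (hτ.mdifferentiable (by simp) x)
  rw [h1] at h2
  exact (congrArg (fun L : E →L[ℝ] E => L v) h2).symm

/-- An invariant metric descends along a covering. -/
theorem exists_metric_descend (hπ : IsLocalDiffeomorph I I ∞ pr) (hs : Function.Surjective pr)
    (g : SmoothMetric I X)
    (hdeck : ∀ x y, pr x = pr y → ∃ τ : X → X, ContMDiff I I ∞ τ ∧ τ x = y ∧ (∀ z, pr (τ z) = pr z) ∧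
      PullsBackMetric τ g.inner g.inner) :
    ∃ h : SmoothMetric I M, PullsBackMetric pr g.inner h.inner := by
  obtain ⟨sec, hsec⟩ := hs.hasRightInverse
  let h₀ : M → E →L[ℝ] E →L[ℝ] ℝ := fun z =>
    (BilinField.val g.inner (sec z)).bilinearComp (hπ.diffInv (sec z)) (hπ.diffInv (sec z))
  let h : BilinField I M := h₀
  have hval : ∀ z u v, h.val z u v =
      BilinField.val g.inner (sec z) (hπ.diffInv (sec z) u) (hπ.diffInv (sec z) v) :=
    fun z u v => rfl
  have key : ∀ x (u v : E), h.val (pr x) (diffAt I I pr x u) (diffAt I I pr x v) =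
      BilinField.val g.inner x u v := by
    intro x u v
    obtain ⟨τ, hτ, hτx, hπτ, hτg⟩ := hdeck x (sec (pr x)) (hsec (pr x)).symm
    rw [hval, ← diffAt_deck hπ.contMDiff hτ hπτ x u, ← diffAt_deck hπ.contMDiff hτ hπτ x v, ← hτx,
      hπ.diffInv_diffAt, hπ.diffInv_diffAt]
    exact hτg.val x u v
  have hpos : ∀ z (v : E), v ≠ 0 → 0 < h.val z v v := by
    intro z v hv
    refine g.pos (sec z) (hπ.diffInv (sec z) v) fun h0 => hv ?_
    have := hπ.diffAt_diffInv (sec z) v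
    rw [← this]
    exact (congrArg (diffAt I I pr (sec z)) h0).trans (map_zero _)
  refine ⟨{
    inner := h
    symm := fun z u v => g.symm (sec z) (hπ.diffInv (sec z) u) (hπ.diffInv (sec z) v)
    pos := hpos
    isVonNBounded := fun z => isVonNBounded_of_pos (h.val z) (hpos z)
    contMDiff := fun z => BilinField.contMDiffAt_iff.2 ?_ }, key⟩
  have hz : z ∈ (hπ (sec z)).localInverse.source := by
    have := (hπ (sec z)).localInverse_mem_source
    rwa [hsec z] at this
  refine BilinField.contDiffAt_inChart_of_pullback (f := (hπ (sec z)).localInverse)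
    ((hπ (sec z)).localInverse_contMDiffOn.contMDiffAt
      ((hπ (sec z)).localInverse.open_source.mem_nhds hz)) (smoothMetric_contDiffAt g _) ?_
  filter_upwards [(hπ (sec z)).localInverse.open_source.mem_nhds hz] with w hw u v
  rw [← key, hπ.diffAt_diffAt_localInverse hw, hπ.diffAt_diffAt_localInverse hw,
    (hπ (sec z)).localInverse_right_inv hw]

/-- An invariant complex structure descends along a covering. -/
theorem exists_complexStructure_descend (hπ : IsLocalDiffeomorph I I ∞ pr)
    (hs : Function.Surjective pr) {J : EndField I X} (hJ : IsComplexStructure J)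
    (hdeck : ∀ x y, pr x = pr y → ∃ τ : X → X, ContMDiff I I ∞ τ ∧ τ x = y ∧ (∀ z, pr (τ z) = pr z) ∧
      Intertwines τ J J) :
    ∃ J' : EndField I M, IsComplexStructure J' ∧ Intertwines pr J J' := by
  obtain ⟨sec, hsec⟩ := hs.hasRightInverse
  let J' : EndField I M := fun z =>
    (diffAt I I pr (sec z)).comp ((J.val (sec z)).comp (hπ.diffInv (sec z)))
  have hval : ∀ z u, J'.val z u =
      diffAt I I pr (sec z) (J.val (sec z) (hπ.diffInv (sec z) u)) := fun z u => rfl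
  have key : ∀ x (u : E), diffAt I I pr x (J.val x u) = J'.val (pr x) (diffAt I I pr x u) := by
    intro x u
    obtain ⟨τ, hτ, hτx, hπτ, hτJ⟩ := hdeck x (sec (pr x)) (hsec (pr x)).symm
    rw [hval, ← diffAt_deck hπ.contMDiff hτ hπτ x u, ← hτx, hπ.diffInv_diffAt, ← hτJ.val,
      diffAt_deck hπ.contMDiff hτ hπτ]
  have hloc : ∀ x w, w ∈ (hπ x).localInverse.source → ∀ u,
      diffAt I I (hπ x).localInverse w (J'.val w u) =
        J.val ((hπ x).localInverse w) (diffAt I I (hπ x).localInverse w u) := by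
    intro x w hw u
    have h1 := key ((hπ x).localInverse w) (diffAt I I (hπ x).localInverse w u)
    rw [hπ.diffAt_diffAt_localInverse hw, (hπ x).localInverse_right_inv hw] at h1
    rw [← h1, ← hπ.diffInv_diffAt ((hπ x).localInverse w)
      (diffAt I I (hπ x).localInverse w _), hπ.diffAt_diffAt_localInverse hw, hπ.diffInv_diffAt]
  have hsrc : ∀ z, z ∈ (hπ (sec z)).localInverse.source := fun z => by
    have := (hπ (sec z)).localInverse_mem_source
    rwa [hsec z] at this
  refine ⟨J', ⟨fun z => EndField.contMDiffAt_iff.2 ?_, fun z u => ?_, fun z => ?_⟩, key⟩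
  · refine EndField.contDiffAt_inChart_of_intertwines (f := (hπ (sec z)).localInverse)
      ((hπ (sec z)).localInverse_contMDiffOn.contMDiffAt
        ((hπ (sec z)).localInverse.open_source.mem_nhds (hsrc z))) (hJ.contDiffAt _) ?_ ?_
    · filter_upwards [(hπ (sec z)).localInverse.open_source.mem_nhds (hsrc z)] with w hw u
      exact hloc _ w hw u
    · refine ContinuousLinearMap.IsInvertible.of_inverse
        (g := diffAt I I pr ((hπ (sec z)).localInverse z)) ?_ ?_
      · ext v
        have h1 := hπ.diffAt_diffAt_localInverse (hsrc z)
          (diffAt I I pr ((hπ (sec z)).localInverse z) v)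
        have h2 := congrArg (hπ.diffInv ((hπ (sec z)).localInverse z)) h1
        rwa [hπ.diffInv_diffAt, hπ.diffInv_diffAt] at h2
      · ext v
        exact hπ.diffAt_diffAt_localInverse (hsrc z) v
  · have h1 : ∀ u : E, J'.val z (J'.val z u) = -u := by
      intro u
      rw [hval, hval, hπ.diffInv_diffAt]
      have h2 : J.val (sec z) (J.val (sec z) (hπ.diffInv (sec z) u)) = -hπ.diffInv (sec z) u :=
        hJ.sq _ _
      rw [h2, map_neg, hπ.diffAt_diffInv]
    exact h1 u
  · obtain ⟨r, φ, hφ, hφJ⟩ := hJ.integrable ((hπ (sec z)).localInverse z)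
    refine ⟨r, (hπ (sec z)).localInverse.trans φ, ⟨hsrc z, hφ⟩, ?_⟩
    rintro y ⟨hy, hyφ⟩ u j
    have hd : diffAt I 𝓘(ℝ, Fin r → ℂ) ((hπ (sec z)).localInverse.trans φ) y =
        (diffAt I 𝓘(ℝ, Fin r → ℂ) φ ((hπ (sec z)).localInverse y)).comp
          (diffAt I I (hπ (sec z)).localInverse y) :=
      diffAt_comp (φ.mdifferentiableAt (by simp) hyφ)
        (hπ.localInverse_mdifferentiableAt_of_mem hy)
    have h1 : ∀ v : E, diffAt I 𝓘(ℝ, Fin r → ℂ) ((hπ (sec z)).localInverse.trans φ) y v =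
        diffAt I 𝓘(ℝ, Fin r → ℂ) φ ((hπ (sec z)).localInverse y)
          (diffAt I I (hπ (sec z)).localInverse y v) := fun v => by rw [hd]; rfl
    have h2 := (h1 (J'.val y u)).trans
      (congrArg (diffAt I 𝓘(ℝ, Fin r → ℂ) φ ((hπ (sec z)).localInverse y)) (hloc _ y hy u))
    refine (congrFun h2 j).trans (Eq.trans (hφJ _ hyφ _ j) ?_)
    exact (congrArg (Complex.I * ·) (congrFun (h1 u) j)).symm

/-- A form that pulls back to `β` under a surjective local diffeomorphism is determined by `β`. -/
lemma FormField.pullback_injective {k : ℕ} (hπ : IsLocalDiffeomorph I I ∞ pr)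
    (hs : Function.Surjective pr) {α β : FormField I M k}
    (h : α.pullback (I := I) pr = β.pullback pr) : α = β := by
  refine FormField.ext_val fun z v => ?_
  obtain ⟨x, rfl⟩ := hs z
  have h1 := congrArg (fun γ : FormField I X k => γ.val x fun i => hπ.diffInv x (v i)) h
  simp only [FormField.pullback_apply, hπ.diffAt_diffInv] at h1
  exact h1

/-- A generalized Kähler structure that is invariant under the deck transformations descends along
a covering. -/
theorem exists_generalizedKahler_descend (hπ : IsLocalDiffeomorph I I ∞ pr)
    (hs : Function.Surjective pr) (S : GeneralizedKahlerStructure I X)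
    (hdeck : ∀ x y, pr x = pr y → ∃ τ : X → X, ContMDiff I I ∞ τ ∧ τ x = y ∧ (∀ z, pr (τ z) = pr z) ∧
      PullsBackMetric τ S.plus.metric.inner S.plus.metric.inner ∧
      Intertwines τ S.plus.J S.plus.J ∧ Intertwines τ S.minus.J S.minus.J) :
    ∃ T : GeneralizedKahlerStructure I M,
      PullsBackMetric pr S.plus.metric.inner T.plus.metric.inner ∧
      Intertwines pr S.plus.J T.plus.J ∧ Intertwines pr S.minus.J T.minus.J := by
  obtain ⟨h, hh⟩ := exists_metric_descend hπ hs S.plus.metric fun x y hxy => by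
    obtain ⟨τ, h1, h2, h3, h4, -⟩ := hdeck x y hxy
    exact ⟨τ, h1, h2, h3, h4⟩
  obtain ⟨J₁, hJ₁, hπ₁⟩ := exists_complexStructure_descend hπ hs S.plus.isComplex
    fun x y hxy => by
      obtain ⟨τ, h1, h2, h3, -, h4, -⟩ := hdeck x y hxy
      exact ⟨τ, h1, h2, h3, h4⟩
  obtain ⟨J₂, hJ₂, hπ₂⟩ := exists_complexStructure_descend hπ hs S.minus.isComplex
    fun x y hxy => by
      obtain ⟨τ, h1, h2, h3, -, -, h4⟩ := hdeck x y hxy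
      exact ⟨τ, h1, h2, h3, h4⟩
  have hcompat : ∀ (J : EndField I X) (J' : EndField I M), Intertwines pr J J' →
      IsCompatible S.plus.metric.inner J → IsCompatible h.inner J' := by
    intro J J' hJJ' hJ z
    obtain ⟨x, rfl⟩ := hs z
    have h1 : ∀ u v : E, BilinField.val h.inner (pr x) (J'.val (pr x) u) (J'.val (pr x) v) =
        BilinField.val h.inner (pr x) u v := by
      intro u v
      rw [← hπ.diffAt_diffInv x u, ← hπ.diffAt_diffInv x v, ← hJJ'.val, ← hJJ'.val, hh.val, hh.val]
      exact hJ x _ _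
    exact h1
  let T₁ : HermitianStructure I M := ⟨h, J₁, hJ₁, hcompat _ _ hπ₁ S.plus.compatible⟩
  let T₂ : HermitianStructure I M := ⟨h, J₂, hJ₂, hcompat _ _ hπ₂ (by
    have := S.minus.compatible
    rwa [← S.same_metric] at this)⟩
  have h₁ : S.plus.dcOmega = T₁.dcOmega.pullback pr :=
    HermitianStructure.dcOmega_eq_pullback hπ.contMDiff hh hπ₁
  have h₂ : S.minus.dcOmega = T₂.dcOmega.pullback pr :=
    HermitianStructure.dcOmega_eq_pullback (T := T₂) hπ.contMDiff (by rw [← S.same_metric]; exact hh)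
      hπ₂
  refine ⟨⟨T₁, T₂, rfl, ?_, ?_⟩, hh, hπ₁, hπ₂⟩
  · refine FormField.pullback_injective hπ hs ?_
    rw [← h₁, S.torsion_eq, h₂]
    rfl
  · refine FormField.pullback_injective hπ hs ?_
    rw [← FormField.d_pullback T₁.dcOmega_isDifferentiable hπ.contMDiff, ← h₁, S.torsion_closed]
    rfl

end Descend

/-! ### The torsion of invariant Hermitian structures: linear algebra -/

section Algebra

variable {E : Type*} [NormedAddCommGroup E] [NormedSpace ℝ E]
  {V : Type*} [NormedAddCommGroup V] [NormedSpace ℝ V]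

/-- First derivative of a metric in an invariant frame. -/
lemma fderiv_metric_of_frame {gc : E → E →L[ℝ] E →L[ℝ] ℝ} {fr : E → E →L[ℝ] E} {p : E}
    (hg : DifferentiableAt ℝ gc p) (hfr : DifferentiableAt ℝ fr p) (hp : ∀ v, fr p v = v)
    (h : ∀ᶠ a in 𝓝 p, ∀ u v, gc a (fr a u) (fr a v) = gc p u v) (X u v : E) :
    fderiv ℝ gc p X u v + gc p (fderiv ℝ fr p X u) v + gc p u (fderiv ℝ fr p X v) = 0 := by
  have h1 : (fun a => gc a (fr a u) (fr a v)) =ᶠ[𝓝 p] fun _ => gc p u v := by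
    filter_upwards [h] with a ha using ha u v
  have hu := hfr.hasFDerivAt.clm_apply (hasFDerivAt_const u p)
  have hv := hfr.hasFDerivAt.clm_apply (hasFDerivAt_const v p)
  have h2 := (hg.hasFDerivAt.clm_apply hu).clm_apply hv
  have h3 := h2.unique ((hasFDerivAt_const (gc p u v) p).congr_of_eventuallyEq h1)
  have h4 := congrArg (fun L : E →L[ℝ] ℝ => L X) h3
  simp [hp] at h4
  linarith

/-- First derivative of a complex structure in an invariant frame. -/
lemma fderiv_complex_of_frame {Jc fr : E → E →L[ℝ] E} {p : E}
    (hJ : DifferentiableAt ℝ Jc p) (hfr : DifferentiableAt ℝ fr p) (hp : ∀ v, fr p v = v)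
    (h : ∀ᶠ a in 𝓝 p, ∀ u, fr a (Jc p u) = Jc a (fr a u)) (X u : E) :
    fderiv ℝ Jc p X u = fderiv ℝ fr p X (Jc p u) - Jc p (fderiv ℝ fr p X u) := by
  have h1 : (fun a => Jc a (fr a u)) =ᶠ[𝓝 p] fun a => fr a (Jc p u) := by
    filter_upwards [h] with a ha using (ha u).symm
  have h2 := hJ.hasFDerivAt.clm_apply (hfr.hasFDerivAt.clm_apply (hasFDerivAt_const u p))
  have h3 := (hfr.hasFDerivAt.clm_apply (hasFDerivAt_const (Jc p u) p)).congr_of_eventuallyEq h1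
  have h4 := congrArg (fun L : E →L[ℝ] E => L X) (h2.unique h3)
  simp [hp] at h4
  rw [← h4]
  abel

/-- The vanishing of the Nijenhuis tensor of a complex structure with a holomorphic chart. -/
lemma nijenhuis_of_chart {r : ℕ} {Jc : E → E →L[ℝ] E} {ψ : E → Fin r → ℂ} {p : E}
    (hJ : DifferentiableAt ℝ Jc p) (hψ : ContDiffAt ℝ ∞ ψ p)
    (hinj : Function.Injective (fderiv ℝ ψ p))
    (h : ∀ᶠ a in 𝓝 p, ∀ u, fderiv ℝ ψ a (Jc a u) = Complex.I • fderiv ℝ ψ a u) (X Y : E) :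
    fderiv ℝ Jc p (Jc p X) Y - fderiv ℝ Jc p (Jc p Y) X - Jc p (fderiv ℝ Jc p X Y) +
      Jc p (fderiv ℝ Jc p Y X) = 0 := by
  have hd : DifferentiableAt ℝ (fderiv ℝ ψ) p :=
    (hψ.fderiv_right (m := ∞) (by simp)).differentiableAt (by simp)
  have hsym : IsSymmSndFDerivAt ℝ ψ p :=
    hψ.isSymmSndFDerivAt (by rw [minSmoothness_of_isRCLikeNormedField]; exact ENat.LEInfty.out)
  have hp := h.self_of_nhds
  have key : ∀ X Y, fderiv ℝ ψ p (fderiv ℝ Jc p X Y) =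
      Complex.I • fderiv ℝ (fderiv ℝ ψ) p X Y - fderiv ℝ (fderiv ℝ ψ) p X (Jc p Y) := by
    intro X Y
    have h1 : (fun a => fderiv ℝ ψ a (Jc a Y)) =ᶠ[𝓝 p] fun a => Complex.I • fderiv ℝ ψ a Y := by
      filter_upwards [h] with a ha using ha Y
    have h2 := hd.hasFDerivAt.clm_apply (hJ.hasFDerivAt.clm_apply (hasFDerivAt_const Y p))
    have h3 := ((hd.hasFDerivAt.clm_apply (hasFDerivAt_const Y p)).const_smul
      Complex.I).congr_of_eventuallyEq h1
    have h4 := congrArg (fun L : E →L[ℝ] (Fin r → ℂ) => L X) (h2.unique h3)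
    simp at h4
    rw [← h4]
    abel
  apply hinj
  rw [map_zero, map_add, map_sub, map_sub, hp, hp, key, key, key, key,
    hsym (Jc p Y) X, hsym (Jc p Y) (Jc p X), hsym Y X, hsym Y (Jc p X)]
  simp only [smul_sub, smul_smul, Complex.I_mul_I]
  rw [hsym X (Jc p Y), hsym X Y]
  simp only [neg_smul, one_smul]
  rw [hsym (Jc p X) Y, hsym (Jc p X) (Jc p Y), hsym Y (Jc p X)]
  abel

/-- The torsion of an invariant Hermitian structure at a point is given by the Lie bracket
`B(u, v) - B(v, u)`. -/
lemma torsion_eq_bracket {g : E →L[ℝ] E →L[ℝ] ℝ} {J : E →L[ℝ] E} {B : E →L[ℝ] E →L[ℝ] E}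
    (hsymm : ∀ u v, g u v = g v u) (hsq : ∀ u, J (J u) = -u)
    (hcomp : ∀ u v, g (J u) (J v) = g u v)
    (hinv : ∀ X u v, g (B X u - B u X) v + g u (B X v - B v X) = 0)
    {DG : E →L[ℝ] E →L[ℝ] E →L[ℝ] ℝ} {DJ : E →L[ℝ] E →L[ℝ] E}
    (hDG : ∀ X u v, DG X u v + g (B X u) v + g u (B X v) = 0)
    (hDJ : ∀ X u, DJ X u = B X (J u) - J (B X u))
    (hN : ∀ X Y, DJ (J X) Y - DJ (J Y) X - J (DJ X Y) + J (DJ Y X) = 0) (u v w : E) :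
    -((DG (J u) (J (J v)) (J w) + g (DJ (J u) (J v)) (J w)) -
      (DG (J v) (J (J u)) (J w) + g (DJ (J v) (J u)) (J w)) +
      (DG (J w) (J (J u)) (J v) + g (DJ (J w) (J u)) (J v))) =
      g (B u v - B v u) w := by
  have hskew : ∀ a b, g (J a) b = -g a (J b) := by
    intro a b
    have := hcomp a (J b)
    rw [hsq, map_neg] at this
    linarith
  have hDG' : ∀ X a b, DG X a b = -g (B X a) b - g a (B X b) := fun X a b => by
    linarith [hDG X a b]
  have hN' := congrArg (fun z => g z w) (hN u v)
  have i1 := hinv (J w) (J u) v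
  have i2 := hinv (J u) v (J w)
  have i3 := hinv (J v) (J w) u
  have i4 := hinv u (J v) (J w)
  have i5 := hinv (J v) u (J w)
  have i6 := hinv (J u) (J w) v
  simp only [hDJ, hDG', hsq, map_sub, map_add, map_neg, map_zero, sub_apply,
    add_apply, neg_apply, zero_apply, hskew] at *
  have s1 := hsymm v (B (J u) (J w))
  have s2 := hsymm v (B (J w) (J u))
  have s3 := hsymm u (B (J v) (J w))
  have s4 := hsymm u (B (J w) (J v))
  linarith

end Algebra

/-! ### The torsion of invariant Hermitian structures on Lie groups -/

section LieTorsion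

variable {E : Type*} [NormedAddCommGroup E] [NormedSpace ℝ E] [FiniteDimensional ℝ E]
  {H : Type*} [TopologicalSpace H] {I : ModelWithCorners ℝ E H} [I.Boundaryless]
  {N : Type*} [TopologicalSpace N] [ChartedSpace H N]

/-- The exterior derivative of the fundamental form in the preferred chart. -/
lemma HermitianStructure.d_fundamentalForm_val [IsManifold I ∞ N] (S : HermitianStructure I N)
    (x : N) (v : Fin 3 → E) :
    S.fundamentalForm.d.val x v =
      (fderiv ℝ (BilinField.inChart S.metric.inner x) (extChartAt I x x) (v 0)
          (S.Jval x (v 1)) (v 2) +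
        S.gval x (fderiv ℝ (EndField.inChart S.J x) (extChartAt I x x) (v 0) (v 1)) (v 2)) -
      (fderiv ℝ (BilinField.inChart S.metric.inner x) (extChartAt I x x) (v 1)
          (S.Jval x (v 0)) (v 2) +
        S.gval x (fderiv ℝ (EndField.inChart S.J x) (extChartAt I x x) (v 1) (v 0)) (v 2)) +
      (fderiv ℝ (BilinField.inChart S.metric.inner x) (extChartAt I x x) (v 2)
          (S.Jval x (v 0)) (v 1) +
        S.gval x (fderiv ℝ (EndField.inChart S.J x) (extChartAt I x x) (v 2) (v 0)) (v 1)) := by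
  have hx := (extChartAt I x).left_inv (mem_extChartAt_source x)
  have hJ0 : ∀ u, EndField.inChart S.J x (extChartAt I x x) u = S.Jval x u := by
    intro u
    unfold EndField.inChart
    simp only [ContinuousLinearMap.comp_apply]
    rw [frameAt_self, hx, coframeAt_self]
    rfl
  have hg0 : ∀ u w, BilinField.inChart S.metric.inner x (extChartAt I x x) u w =
      S.gval x u w := by
    intro u w
    unfold BilinField.inChart
    simp only [ContinuousLinearMap.bilinearComp_apply]
    rw [frameAt_self, frameAt_self, hx]
    rfl
  have key : ∀ (w : Fin 2 → E) (X : E),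
      fderiv ℝ (fun y => S.fundamentalForm.inChart x y w) (extChartAt I x x) X =
        fderiv ℝ (BilinField.inChart S.metric.inner x) (extChartAt I x x) X
          (S.Jval x (w 0)) (w 1) +
        S.gval x (fderiv ℝ (EndField.inChart S.J x) (extChartAt I x x) X (w 0)) (w 1) := by
    intro w X
    have h1 : (fun y => S.fundamentalForm.inChart x y w) =ᶠ[𝓝 (extChartAt I x x)] fun y =>
        BilinField.inChart S.metric.inner x y (EndField.inChart S.J x y (w 0)) (w 1) := by
      filter_upwards [(isOpen_extChartAt_target x).mem_nhds (mem_extChartAt_target (I := I) x)]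
        with y hy
      exact S.fundamentalForm_inChart hy w
    have h2 := ((((smoothMetric_contDiffAt S.metric x).differentiableAt
      (by simp)).hasFDerivAt.clm_apply
      (((S.isComplex.contDiffAt x).differentiableAt (by simp)).hasFDerivAt.clm_apply
        (hasFDerivAt_const (w 0) _))).clm_apply (hasFDerivAt_const (w 1) _))
    rw [h1.fderiv_eq, h2.fderiv]
    have e1 := hJ0 (w 0)
    have e2 := hg0 (fderiv ℝ (EndField.inChart S.J x) (extChartAt I x x) X (w 0)) (w 1)
    rw [← e1, ← e2]
    generalize extChartAt I x x = p
    simp [add_comm]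
  rw [FormField.d_apply, extDeriv_apply (S.fundamentalForm_isDifferentiable x)]
  simp only [coframeAt_self, key]
  refine (Fin.sum_univ_three _).trans ?_
  generalize extChartAt I x x = p
  simp [Fin.removeNth, Fin.succAbove]
  ring

variable [Group N] [LieGroup I ∞ N]

variable (I) in
/-- The operation `(y, z) ↦ y x⁻¹ z` in the preferred chart at `x`. -/
def heapChart (x : N) (a : E × E) : E :=
  extChartAt I x ((extChartAt I x).symm a.1 * x⁻¹ * (extChartAt I x).symm a.2)

variable (I) in
/-- The differentials at `x` of the left translations, in the preferred chart at `x`. -/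
def leftFrame (x : N) (a : E) : E →L[ℝ] E :=
  (fderiv ℝ (heapChart I x) (a, extChartAt I x x)).comp (ContinuousLinearMap.inr ℝ E E)

variable (I) in
/-- The differentials at `x` of the right translations, in the preferred chart at `x`. -/
def rightFrame (x : N) (a : E) : E →L[ℝ] E :=
  (fderiv ℝ (heapChart I x) (extChartAt I x x, a)).comp (ContinuousLinearMap.inl ℝ E E)

lemma contDiffAt_heapChart (x : N) :
    ContDiffAt ℝ ∞ (heapChart I x) (extChartAt I x x, extChartAt I x x) := by
  rw [← contMDiffAt_iff_contDiffAt]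
  have hx := (extChartAt I x).left_inv (mem_extChartAt_source x)
  have hs := contMDiffAt_extChartAt_symm (I := I) (mem_extChartAt_target x)
  have h1 : ContMDiffAt 𝓘(ℝ, E × E) I ∞ (fun a : E × E => (extChartAt I x).symm a.1)
      (extChartAt I x x, extChartAt I x x) :=
    ContMDiffAt.comp (I' := 𝓘(ℝ, E)) (g := (extChartAt I x).symm) (f := Prod.fst) _ hs
      contDiff_fst.contMDiff.contMDiffAt
  have h2 : ContMDiffAt 𝓘(ℝ, E × E) I ∞ (fun a : E × E => (extChartAt I x).symm a.2)
      (extChartAt I x x, extChartAt I x x) :=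
    ContMDiffAt.comp (I' := 𝓘(ℝ, E)) (g := (extChartAt I x).symm) (f := Prod.snd) _ hs
      contDiff_snd.contMDiff.contMDiffAt
  refine ContMDiffAt.comp (I' := I) (g := extChartAt I x)
    (f := fun a : E × E => (extChartAt I x).symm a.1 * x⁻¹ * (extChartAt I x).symm a.2) _ ?_
    ((h1.mul contMDiffAt_const).mul h2)
  simp only [hx, mul_inv_cancel, one_mul]
  exact contMDiffAt_extChartAt

end LieTorsion

section HeapFrames

variable {E : Type*} [NormedAddCommGroup E] [NormedSpace ℝ E]

/-- The partial derivatives of an operation with neutral element `p`. -/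
lemma frames_of_operation {μ : E × E → E} {p : E} (hμ : ContDiffAt ℝ ∞ μ (p, p))
    (h1 : ∀ᶠ b in 𝓝 p, μ (p, b) = b) (h2 : ∀ᶠ a in 𝓝 p, μ (a, p) = a)
    {lf rf : E → E →L[ℝ] E}
    (hlf : ∀ a, lf a = (fderiv ℝ μ (a, p)).comp (ContinuousLinearMap.inr ℝ E E))
    (hrf : ∀ a, rf a = (fderiv ℝ μ (p, a)).comp (ContinuousLinearMap.inl ℝ E E)) :
    (∀ v, lf p v = v) ∧ (∀ v, rf p v = v) ∧ DifferentiableAt ℝ lf p ∧ DifferentiableAt ℝ rf p ∧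
      ∀ u v, fderiv ℝ rf p u v = fderiv ℝ lf p v u := by
  obtain rfl : lf = _ := funext hlf
  obtain rfl : rf = _ := funext hrf
  have hd : HasFDerivAt μ (fderiv ℝ μ (p, p)) (p, p) :=
    (hμ.differentiableAt (by simp)).hasFDerivAt
  have hd2 : HasFDerivAt (fderiv ℝ μ) (fderiv ℝ (fderiv ℝ μ) (p, p)) (p, p) :=
    ((hμ.fderiv_right (m := ∞) (by simp)).differentiableAt (by simp)).hasFDerivAt
  have hsym : IsSymmSndFDerivAt ℝ μ (p, p) :=
    hμ.isSymmSndFDerivAt (by rw [minSmoothness_of_isRCLikeNormedField]; exact ENat.LEInfty.out)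
  have k1 : HasFDerivAt (fun b : E => ((p, b) : E × E)) (ContinuousLinearMap.inr ℝ E E) p :=
    (hasFDerivAt_const p p).prodMk (hasFDerivAt_id p)
  have k2 : HasFDerivAt (fun a : E => ((a, p) : E × E)) (ContinuousLinearMap.inl ℝ E E) p :=
    (hasFDerivAt_id p).prodMk (hasFDerivAt_const p p)
  have l := (HasFDerivAt.comp p (g := fderiv ℝ μ) (f := fun a : E => (a, p)) hd2 k2).clm_comp
    (hasFDerivAt_const (ContinuousLinearMap.inr ℝ E E) p)
  have r := (HasFDerivAt.comp p (g := fderiv ℝ μ) (f := fun b : E => (p, b)) hd2 k1).clm_comp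
    (hasFDerivAt_const (ContinuousLinearMap.inl ℝ E E) p)
  refine ⟨fun v => ?_, fun v => ?_, l.differentiableAt, r.differentiableAt, fun u v => ?_⟩
  · exact congrArg (fun L : E →L[ℝ] E => L v)
      ((HasFDerivAt.comp p (g := μ) (f := fun b : E => (p, b)) hd k1).unique ((hasFDerivAt_id p).congr_of_eventuallyEq h1))
  · exact congrArg (fun L : E →L[ℝ] E => L v)
      ((HasFDerivAt.comp p (g := μ) (f := fun a : E => (a, p)) hd k2).unique ((hasFDerivAt_id p).congr_of_eventuallyEq h2))
  · have e1 := congrArg (fun L : E →L[ℝ] E →L[ℝ] E => L v u) l.fderiv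
    have e2 := congrArg (fun L : E →L[ℝ] E →L[ℝ] E => L u v) r.fderiv
    refine e2.trans (Eq.trans ?_ e1.symm)
    simp
    exact hsym _ _

end HeapFrames

section LieTorsion

variable {E : Type*} [NormedAddCommGroup E] [NormedSpace ℝ E] [FiniteDimensional ℝ E]
  {H : Type*} [TopologicalSpace H] {I : ModelWithCorners ℝ E H} [I.Boundaryless]
  {N : Type*} [TopologicalSpace N] [ChartedSpace H N]

lemma IsComplexStructure.nijenhuis_inChart [IsManifold I ∞ N] {J : EndField I N}
    (hJ : IsComplexStructure J) (x : N) (X Y : E) :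
    fderiv ℝ (EndField.inChart J x) (extChartAt I x x) (J.val x X) Y -
      fderiv ℝ (EndField.inChart J x) (extChartAt I x x) (J.val x Y) X -
      J.val x (fderiv ℝ (EndField.inChart J x) (extChartAt I x x) X Y) +
      J.val x (fderiv ℝ (EndField.inChart J x) (extChartAt I x x) Y X) = 0 := by
  have hx := (extChartAt I x).left_inv (mem_extChartAt_source x)
  have hJ0 : ∀ u, EndField.inChart J x (extChartAt I x x) u = J.val x u := by
    intro u
    unfold EndField.inChart
    simp only [ContinuousLinearMap.comp_apply]
    rw [frameAt_self, hx, coframeAt_self]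
  obtain ⟨r, φ, hxφ, hφ⟩ := hJ.integrable x
  have hφa : ∀ y ∈ φ.source, ContMDiffAt I 𝓘(ℝ, Fin r → ℂ) ∞ φ y := fun y hy =>
    φ.contMDiffOn.contMDiffAt (φ.open_source.mem_nhds hy)
  have hmem : ∀ᶠ a in 𝓝 (extChartAt I x x), a ∈ (extChartAt I x).target ∧
      (extChartAt I x).symm a ∈ φ.source :=
    Filter.Eventually.and ((isOpen_extChartAt_target x).mem_nhds (mem_extChartAt_target (I := I) x))
      (tendsto_extChartAt_symm x (φ.open_source.mem_nhds hxφ))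
  have hfd : ∀ a, a ∈ (extChartAt I x).target → (extChartAt I x).symm a ∈ φ.source → ∀ u,
      fderiv ℝ (fun a => φ ((extChartAt I x).symm a)) a u =
        diffAt I 𝓘(ℝ, Fin r → ℂ) φ ((extChartAt I x).symm a) (frameAt I x a u) := by
    intro a ha ha' u
    have h1 := diffAt_comp (I := 𝓘(ℝ, E)) (g := φ) (f := (extChartAt I x).symm)
      ((hφa _ ha').mdifferentiableAt (by simp)) (mdifferentiableAt_extChartAt_symm ha)
    rw [← frameAt_eq_diffAt] at h1
    rw [← mfderiv_eq_fderiv]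
    exact congrArg (fun L : E →L[ℝ] (Fin r → ℂ) => L u) h1
  have := nijenhuis_of_chart (Jc := EndField.inChart J x)
    (ψ := fun a => φ ((extChartAt I x).symm a)) (p := extChartAt I x x)
    ((hJ.contDiffAt x).differentiableAt (by simp)) ?_ ?_ ?_ X Y
  · simpa only [hJ0] using this
  · rw [← contMDiffAt_iff_contDiffAt]
    refine ContMDiffAt.comp (I' := I) (g := φ) (f := (extChartAt I x).symm) _ ?_
      (contMDiffAt_extChartAt_symm (mem_extChartAt_target x))
    rw [hx]
    exact hφa x hxφ
  · intro u v huv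
    rw [hfd _ (mem_extChartAt_target x) (by rwa [hx]),
      hfd _ (mem_extChartAt_target x) (by rwa [hx]), frameAt_self, frameAt_self, hx] at huv
    have hl : IsLocalDiffeomorphAt I 𝓘(ℝ, Fin r → ℂ) ∞ φ x := ⟨φ, hxφ, fun _ _ => rfl⟩
    exact (hl.mfderivToContinuousLinearEquiv (by simp)).injective huv
  · filter_upwards [hmem] with a ha u
    rw [hfd a ha.1 ha.2, hfd a ha.1 ha.2]
    unfold EndField.inChart
    simp only [ContinuousLinearMap.comp_apply]
    rw [frameAt_comp_coframeAt ha.1]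
    funext j
    exact hφ _ ha.2 (frameAt I x a u) j

/-- The torsion of a Hermitian structure invariant in a frame. -/
lemma HermitianStructure.dcOmega_val_of_frame [IsManifold I ∞ N] (S : HermitianStructure I N)
    (x : N) {fr fr' : E → E →L[ℝ] E} (hfr : DifferentiableAt ℝ fr (extChartAt I x x))
    (hfr' : DifferentiableAt ℝ fr' (extChartAt I x x))
    (hp : ∀ v, fr (extChartAt I x x) v = v) (hp' : ∀ v, fr' (extChartAt I x x) v = v)
    (hsym : ∀ u v, fderiv ℝ fr' (extChartAt I x x) u v = fderiv ℝ fr (extChartAt I x x) v u)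
    (hg : ∀ᶠ a in 𝓝 (extChartAt I x x), ∀ u v,
      BilinField.inChart S.metric.inner x a (fr a u) (fr a v) = S.gval x u v)
    (hg' : ∀ᶠ a in 𝓝 (extChartAt I x x), ∀ u v,
      BilinField.inChart S.metric.inner x a (fr' a u) (fr' a v) = S.gval x u v)
    (hJ : ∀ᶠ a in 𝓝 (extChartAt I x x), ∀ u,
      fr a (S.Jval x u) = EndField.inChart S.J x a (fr a u)) (v : Fin 3 → E) :
    S.dcOmega.val x v = S.gval x (fderiv ℝ fr (extChartAt I x x) (v 0) (v 1) -
      fderiv ℝ fr (extChartAt I x x) (v 1) (v 0)) (v 2) := by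
  have hx := (extChartAt I x).left_inv (mem_extChartAt_source x)
  have hJ0 : EndField.inChart S.J x (extChartAt I x x) = S.Jval x := by
    ext u
    have := hJ.self_of_nhds u
    rwa [hp, hp, eq_comm] at this
  have hg0 : BilinField.inChart S.metric.inner x (extChartAt I x x) = S.gval x := by
    ext u w
    have := hg.self_of_nhds u w
    rwa [hp, hp] at this
  have dg := (smoothMetric_contDiffAt S.metric x).differentiableAt (by simp)
  have dJ := (S.isComplex.contDiffAt x).differentiableAt (by simp)
  have i1 := fderiv_metric_of_frame dg hfr hp (by simpa only [hg0] using hg)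
  have i2 := fderiv_metric_of_frame dg hfr' hp' (by simpa only [hg0] using hg')
  have i3 := fderiv_complex_of_frame dJ hfr hp (by simpa only [hJ0] using hJ)
  rw [hg0] at i1 i2
  rw [hJ0] at i3
  rw [dcOmega_val, d_fundamentalForm_val]
  refine torsion_eq_bracket (g := S.gval x) (J := S.Jval x) (S.metric.symm x) (S.isComplex.sq x) (S.compatible x) ?_ i1 i3
    (S.isComplex.nijenhuis_inChart x) (v 0) (v 1) (v 2)
  intro X u w
  have j1 := i1 X u w
  have j2 := i2 X u w
  rw [hsym, hsym] at j2
  rw [map_sub, map_sub, sub_apply]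
  linarith

end LieTorsion

section LieTorsion

variable {E : Type*} [NormedAddCommGroup E] [NormedSpace ℝ E] [FiniteDimensional ℝ E]
  {H : Type*} [TopologicalSpace H] {I : ModelWithCorners ℝ E H} [I.Boundaryless]
  {N : Type*} [TopologicalSpace N] [ChartedSpace H N]

lemma inChart_metric_of_frame [IsManifold I ∞ N] {g : BilinField I N} {x : N} {F : N → N} {a : E} {A : E →L[ℝ] E}
    (hF : F x = (extChartAt I x).symm a) (hA : ∀ u, diffAt I I F x u = frameAt I x a (A u))
    (h : PullsBackMetric F g g) (u v : E) :
    BilinField.inChart g x a (A u) (A v) = g.val x u v := by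
  rw [← h.val x u v, hA, hA, hF]
  rfl

lemma inChart_complex_of_frame [IsManifold I ∞ N] {J : EndField I N} {x : N} {F : N → N} {a : E}
    {A : E →L[ℝ] E} (ha : a ∈ (extChartAt I x).target)
    (hF : F x = (extChartAt I x).symm a) (hA : ∀ u, diffAt I I F x u = frameAt I x a (A u))
    (h : Intertwines F J J) (u : E) :
    A (J.val x u) = EndField.inChart J x a (A u) := by
  have h1 := congrArg (coframeAt I x ((extChartAt I x).symm a)) (h.val x u)
  rw [hA, hA, hF, coframeAt_comp_frameAt ha] at h1
  exact h1

variable [Group N] [LieGroup I ∞ N]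

lemma eventually_heapChart_left (x : N) :
    ∀ᶠ b in 𝓝 (extChartAt I x x), heapChart I x (extChartAt I x x, b) = b := by
  filter_upwards [(isOpen_extChartAt_target x).mem_nhds (mem_extChartAt_target (I := I) x)] with b hb
  simp only [heapChart]
  rw [(extChartAt I x).left_inv (mem_extChartAt_source x), mul_inv_cancel, one_mul,
    (extChartAt I x).right_inv hb]

lemma eventually_heapChart_right (x : N) :
    ∀ᶠ a in 𝓝 (extChartAt I x x), heapChart I x (a, extChartAt I x x) = a := by
  filter_upwards [(isOpen_extChartAt_target x).mem_nhds (mem_extChartAt_target (I := I) x)] with b hb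
  simp only [heapChart]
  rw [(extChartAt I x).left_inv (mem_extChartAt_source x), inv_mul_cancel_right,
    (extChartAt I x).right_inv hb]

variable (I) in
lemma frames_at (x : N) :
    (∀ v, leftFrame I x (extChartAt I x x) v = v) ∧
    (∀ v, rightFrame I x (extChartAt I x x) v = v) ∧
    DifferentiableAt ℝ (leftFrame I x) (extChartAt I x x) ∧
    DifferentiableAt ℝ (rightFrame I x) (extChartAt I x x) ∧
    ∀ u v, fderiv ℝ (rightFrame I x) (extChartAt I x x) u v =
      fderiv ℝ (leftFrame I x) (extChartAt I x x) v u :=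
  frames_of_operation (contDiffAt_heapChart x) (eventually_heapChart_left x)
    (eventually_heapChart_right x) (fun _ => rfl) fun _ => rfl

lemma eventually_differentiableAt_heapChart (x : N) :
    ∀ᶠ c in 𝓝 (extChartAt I x x, extChartAt I x x), DifferentiableAt ℝ (heapChart I x) c := by
  filter_upwards [((contDiffAt_heapChart (I := I) x).of_le (m := 1) (by simp)).eventually (by simp)]
    with c hc using hc.differentiableAt one_ne_zero

lemma diffAt_of_chart {F : N → N} (hF : ContMDiff I I ∞ F) {x : N}
    (hx : F x ∈ (extChartAt I x).source) (u : E) :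
    diffAt I I F x u = frameAt I x (extChartAt I x (F x))
      (fderiv ℝ (fun b => extChartAt I x (F ((extChartAt I x).symm b))) (extChartAt I x x) u) := by
  have h0 := (extChartAt I x).left_inv (mem_extChartAt_source x)
  have h1 := mdifferentiableAt_extChartAt_symm (I := I) (mem_extChartAt_target x)
  have h2 := diffAt_eq_frameAt_comp_fderiv (f := fun y => F ((extChartAt I x).symm y))
    (x₀ := x) (p := extChartAt I x x) ((hF.mdifferentiable (by simp) _).comp _ h1) (by rwa [h0])
  rw [diffAt_comp (hF.mdifferentiable (by simp) _) h1, ← frameAt_eq_diffAt, h0] at h2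
  have h3 := congrArg (fun L : E →L[ℝ] E => L u) h2
  simp only [ContinuousLinearMap.comp_apply] at h3
  rwa [frameAt_self] at h3

lemma eventually_leftFrame (x : N) :
    ∀ᶠ a in 𝓝 (extChartAt I x x), a ∈ (extChartAt I x).target ∧ ∀ u,
      diffAt I I (fun z => (extChartAt I x).symm a * x⁻¹ * z) x u =
        frameAt I x a (leftFrame I x a u) := by
  have hc : ContinuousAt (fun a : E => (a, extChartAt I x x)) (extChartAt I x x) := by fun_prop
  filter_upwards [(isOpen_extChartAt_target x).mem_nhds (mem_extChartAt_target (I := I) x),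
    hc.eventually (eventually_differentiableAt_heapChart (I := I) x)] with a ha hd
  refine ⟨ha, fun u => ?_⟩
  have hFx : (extChartAt I x).symm a * x⁻¹ * x = (extChartAt I x).symm a :=
    inv_mul_cancel_right _ _
  have h1 := diffAt_of_chart (I := I) (x := x)
    (F := fun z => (extChartAt I x).symm a * x⁻¹ * z) contMDiff_mul_left
    (by simp only [hFx]; exact (extChartAt I x).map_target ha) u
  simp only [hFx] at h1
  rw [(extChartAt I x).right_inv ha] at h1
  rw [h1]
  congr 1
  have k := (hasFDerivAt_const (𝕜 := ℝ) a (extChartAt I x x)).prodMk (hasFDerivAt_id (𝕜 := ℝ) (extChartAt I x x))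
  exact congrArg (fun L : E →L[ℝ] E => L u) (HasFDerivAt.comp (extChartAt I x x)
    (g := heapChart I x) (f := fun b : E => (a, b)) hd.hasFDerivAt k).fderiv

lemma eventually_rightFrame (x : N) :
    ∀ᶠ a in 𝓝 (extChartAt I x x), a ∈ (extChartAt I x).target ∧ ∀ u,
      diffAt I I (fun z => z * (x⁻¹ * (extChartAt I x).symm a)) x u =
        frameAt I x a (rightFrame I x a u) := by
  have hc : ContinuousAt (fun a : E => (extChartAt I x x, a)) (extChartAt I x x) := by fun_prop
  filter_upwards [(isOpen_extChartAt_target x).mem_nhds (mem_extChartAt_target (I := I) x),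
    hc.eventually (eventually_differentiableAt_heapChart (I := I) x)] with a ha hd
  refine ⟨ha, fun u => ?_⟩
  have hFx : x * (x⁻¹ * (extChartAt I x).symm a) = (extChartAt I x).symm a :=
    mul_inv_cancel_left _ _
  have h1 := diffAt_of_chart (I := I) (x := x)
    (F := fun z => z * (x⁻¹ * (extChartAt I x).symm a)) contMDiff_mul_right
    (by simp only [hFx]; exact (extChartAt I x).map_target ha) u
  simp only [hFx] at h1
  rw [(extChartAt I x).right_inv ha] at h1
  rw [h1]
  congr 1
  have k := (hasFDerivAt_id (𝕜 := ℝ) (extChartAt I x x)).prodMk (hasFDerivAt_const (𝕜 := ℝ) a (extChartAt I x x))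
  have h2 := congrArg (fun L : E →L[ℝ] E => L u) (HasFDerivAt.comp (extChartAt I x x)
    (g := heapChart I x) (f := fun b : E => (b, a)) hd.hasFDerivAt k).fderiv
  refine Eq.trans ?_ h2
  congr 2
  funext b
  simp only [heapChart, Function.comp, mul_assoc]

lemma HermitianStructure.eventually_metric_leftFrame (S : HermitianStructure I N)
    (hb : IsBiInvariantMetric I S.metric.inner) (x : N) :
    ∀ᶠ a in 𝓝 (extChartAt I x x), ∀ u v, BilinField.inChart S.metric.inner x a
      (leftFrame I x a u) (leftFrame I x a v) = S.gval x u v := by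
  filter_upwards [eventually_leftFrame (I := I) x] with a ha
  exact inChart_metric_of_frame (inv_mul_cancel_right _ _) ha.2 (hb _).1

lemma HermitianStructure.eventually_metric_rightFrame (S : HermitianStructure I N)
    (hb : IsBiInvariantMetric I S.metric.inner) (x : N) :
    ∀ᶠ a in 𝓝 (extChartAt I x x), ∀ u v, BilinField.inChart S.metric.inner x a
      (rightFrame I x a u) (rightFrame I x a v) = S.gval x u v := by
  filter_upwards [eventually_rightFrame (I := I) x] with a ha
  exact inChart_metric_of_frame (mul_inv_cancel_left _ _) ha.2 (hb _).2

lemma HermitianStructure.dcOmega_val_of_leftInvariant (S : HermitianStructure I N)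
    (hb : IsBiInvariantMetric I S.metric.inner)
    (hJ : ∀ a : N, Intertwines (fun z => a * z) S.J S.J) (x : N) (v : Fin 3 → E) :
    S.dcOmega.val x v =
      S.gval x (fderiv ℝ (leftFrame I x) (extChartAt I x x) (v 0) (v 1) -
        fderiv ℝ (leftFrame I x) (extChartAt I x x) (v 1) (v 0)) (v 2) := by
  obtain ⟨hp, hp', hd, hd', hs⟩ := frames_at I x
  refine S.dcOmega_val_of_frame x hd hd' hp hp' hs (S.eventually_metric_leftFrame hb x)
    (S.eventually_metric_rightFrame hb x) ?_ v
  filter_upwards [eventually_leftFrame (I := I) x] with a ha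
  exact inChart_complex_of_frame ha.1 (inv_mul_cancel_right _ _) ha.2 (hJ _)

lemma HermitianStructure.dcOmega_val_of_rightInvariant (S : HermitianStructure I N)
    (hb : IsBiInvariantMetric I S.metric.inner)
    (hJ : ∀ a : N, Intertwines (fun z => z * a) S.J S.J) (x : N) (v : Fin 3 → E) :
    S.dcOmega.val x v =
      S.gval x (fderiv ℝ (leftFrame I x) (extChartAt I x x) (v 1) (v 0) -
        fderiv ℝ (leftFrame I x) (extChartAt I x x) (v 0) (v 1)) (v 2) := by
  obtain ⟨hp, hp', hd, hd', hs⟩ := frames_at I x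
  have h := S.dcOmega_val_of_frame x hd' hd hp' hp (fun u v => (hs v u).symm)
    (S.eventually_metric_rightFrame hb x) (S.eventually_metric_leftFrame hb x) ?_ v
  · rwa [hs, hs] at h
  filter_upwards [eventually_rightFrame (I := I) x] with a ha
  exact inChart_complex_of_frame ha.1 (mul_inv_cancel_left _ _) ha.2 (hJ _)

/-- A right-invariant and a left-invariant complex structure, both compatible with the same
bi-invariant metric, have opposite torsion. -/
theorem HermitianStructure.dcOmega_eq_neg_of_invariant {S T : HermitianStructure I N}
    (hST : S.metric = T.metric) (hb : IsBiInvariantMetric I S.metric.inner)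
    (hS : ∀ a : N, Intertwines (fun z => z * a) S.J S.J)
    (hT : ∀ a : N, Intertwines (fun z => a * z) T.J T.J) :
    S.dcOmega = -T.dcOmega := by
  refine FormField.ext_val fun x v => ?_
  have h1 := S.dcOmega_val_of_rightInvariant hb hS x v
  have h2 := T.dcOmega_val_of_leftInvariant (hST ▸ hb) hT x v
  have h3 : S.gval x = T.gval x := by unfold gval; rw [hST]
  rw [h3, ← neg_sub, map_neg, neg_apply, ← h2] at h1
  exact h1

end LieTorsion

/-! ### Bi-invariant forms of odd degree are closed -/

section BiInvariant

variable {E : Type*} [NormedAddCommGroup E] [NormedSpace ℝ E] [FiniteDimensional ℝ E]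
  {H : Type*} [TopologicalSpace H] {I : ModelWithCorners ℝ E H} [I.Boundaryless]
  {N : Type*} [TopologicalSpace N] [ChartedSpace H N]

lemma FormField.d_neg [IsManifold I ∞ N] {k : ℕ} (α : FormField I N k) :
    FormField.d (-α) = -α.d := by
  refine FormField.ext_val fun x v => ?_
  refine (FormField.d_apply _ x v).trans ?_
  refine Eq.trans ?_ (congrArg Neg.neg (FormField.d_apply α x v)).symm
  have : (-α).inChart x = -α.inChart x := rfl
  rw [this]
  simp only [extDeriv, fderiv_neg]
  rw [← ContinuousAlternatingMap.neg_apply]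
  congr 1
  exact map_neg (ContinuousAlternatingMap.alternatizeUncurryFinCLM ℝ E ℝ) _

lemma alternating_apply_neg {k : ℕ} (α : E [⋀^Fin k]→L[ℝ] ℝ) (v : Fin k → E) :
    α (fun i => -v i) = (-1) ^ k * α v := by
  have h := α.toMultilinearMap.map_smul_univ (fun _ => (-1 : ℝ)) v
  simp only [neg_smul, one_smul, Finset.prod_const, Finset.card_univ, Fintype.card_fin] at h
  exact h

variable [Group N] [LieGroup I ∞ N]

variable (I) in
lemma contMDiff_heapInv (x : N) : ContMDiff I I ∞ fun y : N => x * y⁻¹ * x :=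
  (contMDiff_const.mul (contMDiff_inv I ∞)).mul contMDiff_const

variable (I) in
/-- The differential of the geodesic symmetry `y ↦ x y⁻¹ x` at `x` is `-1`. -/
lemma diffAt_heapInv (x : N) (u : E) : diffAt I I (fun y : N => x * y⁻¹ * x) x u = -u := by
  have h0 := (extChartAt I x).left_inv (mem_extChartAt_source x)
  have hxx : x * x⁻¹ * x = x := by rw [mul_inv_cancel, one_mul]
  have hF := contMDiff_heapInv I x
  have h1 := diffAt_of_chart (I := I) (x := x) hF (by rw [hxx]; exact mem_extChartAt_source x) u
  rw [hxx, frameAt_self] at h1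
  rw [h1]
  set c : E → E := fun b => extChartAt I x (x * ((extChartAt I x).symm b)⁻¹ * x) with hc
  have hcp : c (extChartAt I x x) = extChartAt I x x := by
    simp only [hc]
    rw [h0, hxx]
  have hcc : ContMDiffAt 𝓘(ℝ, E) I ∞
      (fun b => x * ((extChartAt I x).symm b)⁻¹ * x) (extChartAt I x x) :=
    hF.contMDiffAt.comp _ (contMDiffAt_extChartAt_symm (mem_extChartAt_target x))
  have hd : DifferentiableAt ℝ c (extChartAt I x x) := by
    refine ContDiffAt.differentiableAt (n := ∞) (contMDiffAt_iff_contDiffAt.1 ?_) (by simp)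
    refine ContMDiffAt.comp (I' := I) (g := extChartAt I x) _ ?_ hcc
    rw [h0, hxx]
    exact contMDiffAt_extChartAt
  have hev : (fun b => heapChart I x (b, c b)) =ᶠ[𝓝 (extChartAt I x x)]
      fun _ => extChartAt I x x := by
    have hm : ∀ᶠ b in 𝓝 (extChartAt I x x),
        x * ((extChartAt I x).symm b)⁻¹ * x ∈ (extChartAt I x).source := by
      refine hcc.continuousAt.eventually_mem ?_
      rw [h0, hxx]
      exact extChartAt_source_mem_nhds x
    filter_upwards [hm] with b hb
    simp only [heapChart, hc]
    rw [(extChartAt I x).left_inv hb]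
    congr 1
    group
  obtain ⟨hl, hr, -⟩ := frames_at I x
  have k := (hasFDerivAt_id (𝕜 := ℝ) (extChartAt I x x)).prodMk hd.hasFDerivAt
  have hμ : HasFDerivAt (heapChart I x) (fderiv ℝ (heapChart I x)
      (extChartAt I x x, extChartAt I x x)) (id (extChartAt I x x), c (extChartAt I x x)) := by
    rw [hcp]
    exact ((contDiffAt_heapChart x).differentiableAt (by simp)).hasFDerivAt
  have hD := (HasFDerivAt.comp (extChartAt I x x) (g := heapChart I x)
    (f := fun b : E => (b, c b)) hμ k).unique
      ((hasFDerivAt_const _ _).congr_of_eventuallyEq hev)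
  have hDu := congrArg (fun L : E →L[ℝ] E => L u) hD
  have e1 := hr u
  have e2 := hl (fderiv ℝ c (extChartAt I x x) u)
  simp only [leftFrame, rightFrame, ContinuousLinearMap.comp_apply,
    ContinuousLinearMap.inr_apply, ContinuousLinearMap.inl_apply] at e1 e2
  have e3 : fderiv ℝ (heapChart I x) (extChartAt I x x, extChartAt I x x)
      (u, fderiv ℝ c (extChartAt I x x) u) = 0 := hDu
  have e4 : ((u, fderiv ℝ c (extChartAt I x x) u) : E × E) =
      (u, 0) + (0, fderiv ℝ c (extChartAt I x x) u) := by simp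
  rw [e4, map_add, e1, e2] at e3
  exact (neg_eq_of_add_eq_zero_right e3).symm

/-- A bi-invariant form of odd degree is closed. -/
theorem FormField.d_eq_zero_of_biInvariant {k : ℕ} (hk : Odd k) {α : FormField I N k}
    (hα : α.IsDifferentiable) (hl : ∀ a : N, α = α.pullback fun z => a * z)
    (hr : ∀ a : N, α = α.pullback fun z => z * a) : α.d = 0 := by
  have hpull : ∀ x : N, (α.pullback fun y => x * y⁻¹ * x) = -α := by
    intro x
    refine FormField.ext_val fun y v => ?_
    rw [FormField.pullback_apply]
    have e1 : (fun z : N => x * z⁻¹ * x) =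
        fun z => (x * y⁻¹) * (y * z⁻¹ * y) * (y⁻¹ * x) := by
      funext z; group
    have m1 : ∀ (a z : N), MDifferentiableAt I I (fun z => a * z) z := fun a z =>
      (contMDiff_mul_left (n := ∞)).mdifferentiable (by simp) z
    have m2 : ∀ (a z : N), MDifferentiableAt I I (fun z => z * a) z := fun a z =>
      (contMDiff_mul_right (n := ∞)).mdifferentiable (by simp) z
    have m3 : MDifferentiableAt I I (fun z => y * z⁻¹ * y) y :=
      (contMDiff_heapInv I y).mdifferentiable (by simp) y
    have hy : y * y⁻¹ * y = y := by rw [mul_inv_cancel, one_mul]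
    have e2 : ∀ u, diffAt I I (fun z : N => x * z⁻¹ * x) y u =
        diffAt I I (fun z => z * (y⁻¹ * x)) (x * y⁻¹ * y)
          (diffAt I I (fun z => x * y⁻¹ * z) y (-u)) := by
      intro u
      rw [e1, diffAt_comp (I' := I) (g := fun w => w * (y⁻¹ * x))
        (f := fun z => (x * y⁻¹) * (y * z⁻¹ * y)) (m2 _ _) ((m1 _ _).comp y m3),
        diffAt_comp (I' := I) (g := fun w => (x * y⁻¹) * w) (f := fun z => y * z⁻¹ * y)
          (m1 _ _) m3]
      simp only [ContinuousLinearMap.comp_apply, diffAt_heapInv, hy]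
    have e3 : x * y⁻¹ * x = x * y⁻¹ * y * (y⁻¹ * x) := by group
    simp only [e2]
    rw [e3]
    have f1 := FormField.pullback_apply (I := I) (fun z => z * (y⁻¹ * x)) α (x * y⁻¹ * y)
      (fun i => diffAt I I (fun z => x * y⁻¹ * z) y (-v i))
    rw [← hr] at f1
    have f2 := FormField.pullback_apply (I := I) (fun z => x * y⁻¹ * z) α y (fun i => -v i)
    rw [← hl] at f2
    refine f1.symm.trans (f2.symm.trans ?_)
    rw [alternating_apply_neg, hk.neg_one_pow, neg_one_mul]
    rfl
  refine FormField.ext_val fun x v => ?_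
  have h := FormField.d_pullback hα (contMDiff_heapInv I x)
  rw [hpull, FormField.d_neg] at h
  have h2 := congrArg (fun β : FormField I N (k + 1) => β.val x v) h
  have hxx : x * x⁻¹ * x = x := by rw [mul_inv_cancel, one_mul]
  have h3 := FormField.pullback_apply (I := I) (fun y => x * y⁻¹ * x) α.d x v
  simp only [diffAt_heapInv, hxx] at h3
  rw [alternating_apply_neg, hk.add_one.neg_one_pow, one_mul] at h3
  have h4 : -(α.d.val x v) = α.d.val x v := h2.trans h3
  change α.d.val x v = 0
  linarith

end BiInvariant

section Torsion

variable {E : Type*} [NormedAddCommGroup E] [NormedSpace ℝ E] [FiniteDimensional ℝ E]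
  {H : Type*} [TopologicalSpace H] {I : ModelWithCorners ℝ E H} [I.Boundaryless]
  {N : Type*} [TopologicalSpace N] [ChartedSpace H N] [Group N] [LieGroup I ∞ N]

/-- The torsion of a bi-invariant metric with a left- and a right-invariant complex structure is
closed. -/
theorem HermitianStructure.d_dcOmega_of_invariant {S T : HermitianStructure I N}
    (hST : S.metric = T.metric) (hb : IsBiInvariantMetric I S.metric.inner)
    (hS : ∀ a : N, Intertwines (fun z => z * a) S.J S.J)
    (hT : ∀ a : N, Intertwines (fun z => a * z) T.J T.J) :
    FormField.d S.dcOmega = 0 := by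
  have hneg := dcOmega_eq_neg_of_invariant hST hb hS hT
  refine FormField.d_eq_zero_of_biInvariant (by decide) S.dcOmega_isDifferentiable (fun a => ?_)
    fun a => dcOmega_eq_pullback contMDiff_mul_right (hb a).2 (hS a)
  have h := dcOmega_eq_pullback contMDiff_mul_left ((hST ▸ hb) a).1 (hT a)
  rw [hneg]
  refine FormField.ext_val fun x v => ?_
  exact congrArg (fun β : FormField I N 3 => -(β.val x v)) h

end Torsion

/-! ### Products of maps, and the Lie group `G × ℝⁿ` -/

section ProdMap

variable {E : Type*} [NormedAddCommGroup E] [NormedSpace ℝ E] [FiniteDimensional ℝ E]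
  {H : Type*} [TopologicalSpace H] {I : ModelWithCorners ℝ E H}
  {M : Type*} [TopologicalSpace M] [ChartedSpace H M]
  {E' : Type*} [NormedAddCommGroup E'] [NormedSpace ℝ E'] [FiniteDimensional ℝ E']
  {H' : Type*} [TopologicalSpace H'] {I' : ModelWithCorners ℝ E' H'}
  {M' : Type*} [TopologicalSpace M'] [ChartedSpace H' M']
  [I.Boundaryless] [I'.Boundaryless] [IsManifold I ∞ M] [IsManifold I' ∞ M']

lemma diffAt_prodMap {f : M → M} {f' : M' → M'} (hf : ContMDiff I I ∞ f)
    (hf' : ContMDiff I' I' ∞ f') (x : M × M') (u : E × E') :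
    diffAt (I.prod I') (I.prod I') (fun x : M × M' => (f x.1, f' x.2)) x u =
      (diffAt I I f x.1 u.1, diffAt I' I' f' x.2 u.2) := by
  have h : diffAt (I.prod I') (I.prod I') (fun x : M × M' => (f x.1, f' x.2)) x =
      (diffAt I I f x.1).prodMap (diffAt I' I' f' x.2) :=
    mfderiv_prodMap (hf.mdifferentiable (by simp) _) (hf'.mdifferentiable (by simp) _)
  rw [h]
  rfl

lemma PullsBackMetric.prodMap {f : M → M} {f' : M' → M'} (hf : ContMDiff I I ∞ f)
    (hf' : ContMDiff I' I' ∞ f') {g : BilinField I M} {g' : BilinField I' M'}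
    (h : PullsBackMetric f g g) (h' : PullsBackMetric f' g' g') :
    PullsBackMetric (fun x : M × M' => (f x.1, f' x.2)) (prodBilin g g') (prodBilin g g') := by
  intro x
  have key : ∀ u v : E × E', (prodBilin g g').val (f x.1, f' x.2)
      (diffAt (I.prod I') (I.prod I') (fun x : M × M' => (f x.1, f' x.2)) x u)
      (diffAt (I.prod I') (I.prod I') (fun x : M × M' => (f x.1, f' x.2)) x v) =
        (prodBilin g g').val x u v := fun u v => by
    rw [diffAt_prodMap hf hf', diffAt_prodMap hf hf', prodBilin_val, prodBilin_val,
      h.val, h'.val]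
  exact key

lemma Intertwines.prodMap {f : M → M} {f' : M' → M'} (hf : ContMDiff I I ∞ f)
    (hf' : ContMDiff I' I' ∞ f') {J : EndField I M} {J' : EndField I' M'}
    (h : Intertwines f J J) (h' : Intertwines f' J' J') :
    Intertwines (fun x : M × M' => (f x.1, f' x.2)) (_root_.prodEnd J J')
      (_root_.prodEnd J J') := by
  intro x
  have key : ∀ u : E × E',
      diffAt (I.prod I') (I.prod I') (fun x : M × M' => (f x.1, f' x.2)) x
        ((_root_.prodEnd J J').val x u) = (_root_.prodEnd J J').val (f x.1, f' x.2)
      (diffAt (I.prod I') (I.prod I') (fun x : M × M' => (f x.1, f' x.2)) x u) := fun u => by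
    rw [diffAt_prodMap hf hf', diffAt_prodMap hf hf', prodEnd_val, prodEnd_val, h.val, h'.val]
  exact key

end ProdMap

section Euclidean

/-- The Euclidean metric, as a smooth metric. -/
def euclideanMetric (n : ℕ) :
    SmoothMetric 𝓘(ℝ, EuclideanSpace ℝ (Fin n)) (EuclideanSpace ℝ (Fin n)) where
  inner := euclideanBilin n
  symm := (riemannianMetricVectorSpace (EuclideanSpace ℝ (Fin n))).symm
  pos := (riemannianMetricVectorSpace (EuclideanSpace ℝ (Fin n))).pos
  isVonNBounded := (riemannianMetricVectorSpace (EuclideanSpace ℝ (Fin n))).isVonNBounded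
  contMDiff := (riemannianMetricVectorSpace (EuclideanSpace ℝ (Fin n))).contMDiff.of_le le_top

lemma pullsBackMetric_const_add {n : ℕ} (a : EuclideanSpace ℝ (Fin n)) :
    PullsBackMetric (fun t => a + t) (euclideanBilin n) (euclideanBilin n) := by
  intro x
  have h : diffAt 𝓘(ℝ, EuclideanSpace ℝ (Fin n)) 𝓘(ℝ, EuclideanSpace ℝ (Fin n))
      (fun t => a + t) x = ContinuousLinearMap.id ℝ _ := by
    refine mfderiv_eq_fderiv.trans ?_
    rw [fderiv_const_add]
    exact fderiv_id
  have key : ∀ u v : EuclideanSpace ℝ (Fin n), (euclideanBilin n).val (a + x)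
      (diffAt 𝓘(ℝ, EuclideanSpace ℝ (Fin n)) 𝓘(ℝ, EuclideanSpace ℝ (Fin n)) (fun t => a + t) x u)
      (diffAt 𝓘(ℝ, EuclideanSpace ℝ (Fin n)) 𝓘(ℝ, EuclideanSpace ℝ (Fin n)) (fun t => a + t) x v) =
      (euclideanBilin n).val x u v := fun u v => by
    rw [h]
    rfl
  exact key

lemma pullsBackMetric_add_const {n : ℕ} (a : EuclideanSpace ℝ (Fin n)) :
    PullsBackMetric (fun t => t + a) (euclideanBilin n) (euclideanBilin n) := by
  have h : (fun t => t + a) = fun t => a + t := funext fun t => add_comm t a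
  rw [h]
  exact pullsBackMetric_const_add a

/-- The product of a multiplicative and an additive group. -/
abbrev prodVectorGroup (G V : Type*) [Group G] [AddCommGroup V] : Group (G × V) where
  mul a b := (a.1 * b.1, a.2 + b.2)
  one := (1, 0)
  inv a := (a.1⁻¹, -a.2)
  mul_assoc a b c := Prod.ext (mul_assoc _ _ _) (add_assoc _ _ _)
  one_mul a := Prod.ext (one_mul _) (zero_add _)
  mul_one a := Prod.ext (mul_one _) (add_zero _)
  inv_mul_cancel a := Prod.ext (inv_mul_cancel _) (neg_add_cancel _)

variable {E : Type*} [NormedAddCommGroup E] [NormedSpace ℝ E] [FiniteDimensional ℝ E]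
  {H : Type*} [TopologicalSpace H] {I : ModelWithCorners ℝ E H} [I.Boundaryless]
  {G : Type*} [TopologicalSpace G] [ChartedSpace H G] [Group G] [LieGroup I ∞ G]

lemma lieGroup_prodVectorGroup (V : Type*) [NormedAddCommGroup V] [NormedSpace ℝ V] :
    letI := prodVectorGroup G V
    LieGroup (I.prod 𝓘(ℝ, V)) ∞ (G × V) := by
  let := prodVectorGroup G V
  have : IsManifold (I.prod 𝓘(ℝ, V)) ∞ (G × V) := inferInstance
  refine { contMDiff_mul := ?_, contMDiff_inv := ?_ }
  · exact ContMDiff.prodMk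
      ((contMDiff_fst.comp contMDiff_fst).mul (contMDiff_fst.comp contMDiff_snd))
      ((contMDiff_snd.comp contMDiff_fst).add (contMDiff_snd.comp contMDiff_snd))
  · exact ContMDiff.prodMk (contMDiff_fst.inv) (contMDiff_snd.neg)

lemma isBiInvariantMetric_prod {n : ℕ} {b : SmoothMetric I G}
    (hb : IsBiInvariantMetric I b.inner) :
    letI := prodVectorGroup G (EuclideanSpace ℝ (Fin n))
    IsBiInvariantMetric (I.prod 𝓘(ℝ, EuclideanSpace ℝ (Fin n)))
      (prodMetric b (euclideanMetric n)).inner := by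
  let := prodVectorGroup G (EuclideanSpace ℝ (Fin n))
  intro a
  exact ⟨PullsBackMetric.prodMap contMDiff_mul_left contMDiff_add_left (hb a.1).1
      (pullsBackMetric_const_add a.2),
    PullsBackMetric.prodMap contMDiff_mul_right contMDiff_add_right (hb a.1).2
      (pullsBackMetric_add_const a.2)⟩

/-- The torsions of a right- and a left-invariant complex structure on `G × ℝⁿ`. -/
lemma torsion_prodVectorGroup {n : ℕ} {b : SmoothMetric I G}
    (hb : IsBiInvariantMetric I b.inner)
    {S T : HermitianStructure (I.prod 𝓘(ℝ, EuclideanSpace ℝ (Fin n)))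
      (G × EuclideanSpace ℝ (Fin n))}
    (hSm : S.metric = prodMetric b (euclideanMetric n))
    (hTm : T.metric = prodMetric b (euclideanMetric n))
    (hS : IsRightInvariant S.J) (hT : IsLeftInvariant T.J) :
    S.dcOmega = -T.dcOmega ∧ FormField.d S.dcOmega = 0 := by
  let := prodVectorGroup G (EuclideanSpace ℝ (Fin n))
  have := lieGroup_prodVectorGroup (I := I) (G := G) (EuclideanSpace ℝ (Fin n))
  have hb' := isBiInvariantMetric_prod (n := n) hb
  rw [← hSm] at hb'
  exact ⟨HermitianStructure.dcOmega_eq_neg_of_invariant (hSm.trans hTm.symm) hb' hS hT,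
    HermitianStructure.d_dcOmega_of_invariant (hSm.trans hTm.symm) hb' hS hT⟩

end Euclidean

section KahlerProduct

variable {E : Type*} [NormedAddCommGroup E] [NormedSpace ℝ E] [FiniteDimensional ℝ E]
  {H : Type*} [TopologicalSpace H] {I : ModelWithCorners ℝ E H} [I.Boundaryless]
  {M : Type*} [TopologicalSpace M] [ChartedSpace H M] [IsManifold I ∞ M]
  {E' : Type*} [NormedAddCommGroup E'] [NormedSpace ℝ E'] [FiniteDimensional ℝ E']
  {H' : Type*} [TopologicalSpace H'] {I' : ModelWithCorners ℝ E' H'} [I'.Boundaryless]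
  {M' : Type*} [TopologicalSpace M'] [ChartedSpace H' M'] [IsManifold I' ∞ M']

/-- The product of a Kähler and a generalized Kähler manifold. -/
def HermitianStructure.prodGeneralizedKahler (S : HermitianStructure I M) (hS : S.IsKahler)
    (T : GeneralizedKahlerStructure I' M') :
    GeneralizedKahlerStructure (I.prod I') (M × M') where
  plus := S.prod T.plus
  minus := S.prod T.minus
  same_metric := congrArg (prodMetric S.metric) T.same_metric
  torsion_eq := by
    rw [prod_dcOmega_of_isKahler _ hS, prod_dcOmega_of_isKahler _ hS, T.torsion_eq]
    rfl
  torsion_closed := by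
    rw [prod_dcOmega_of_isKahler _ hS,
      FormField.d_pullback T.plus.dcOmega_isDifferentiable contMDiff_snd, T.torsion_closed]
    rfl

end KahlerProduct

/-! ### The action of `ℤⁿ` -/

section LatticeAction

variable {K G : Type*} {n : ℕ} {A : Subgroup (Equiv.Perm K)} {B : Subgroup (Equiv.Perm G)}

lemma latticeVec_injective : Function.Injective (latticeVec : Multiplicative (Fin n → ℤ) → _) := by
  intro m m' h
  refine Multiplicative.toAdd.injective (funext fun i => ?_)
  have := congrArg (fun v : EuclideanSpace ℝ (Fin n) => v i) h
  simpa [latticeVec] using this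

lemma finite_latticeVec_norm_le (R : ℝ) :
    {m : Multiplicative (Fin n → ℤ) | ‖latticeVec m‖ ≤ R}.Finite := by
  have h : Set.Finite (Set.pi Set.univ fun _ : Fin n => Set.Icc (-⌈R⌉) ⌈R⌉) :=
    Set.Finite.pi fun _ => Set.finite_Icc _ _
  refine (h.preimage Multiplicative.toAdd.injective.injOn).subset fun m hm i _ => ?_
  have h1 : |((Multiplicative.toAdd m i : ℤ) : ℝ)| ≤ R :=
    (PiLp.norm_apply_le (latticeVec m) i).trans hm
  have h2 := abs_le.1 (h1.trans (Int.le_ceil R))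
  exact ⟨by exact_mod_cast h2.1, by exact_mod_cast h2.2⟩

variable (ψ : Multiplicative (Fin n → ℤ) →* A) (ρ : Multiplicative (Fin n → ℤ) →* B)

lemma latticeAction_free (m : Multiplicative (Fin n → ℤ)) (x : K × G × EuclideanSpace ℝ (Fin n))
    (h : (latticeAction ψ ρ).smul m x = x) : m = 1 := by
  have h1 : x.2.2 + latticeVec m = x.2.2 := congrArg (fun y => y.2.2) h
  have h2 : latticeVec m = latticeVec (1 : Multiplicative (Fin n → ℤ)) := by
    rw [add_eq_left.1 h1]
    ext i
    simp [latticeVec]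
  exact latticeVec_injective h2

variable [TopologicalSpace K] [TopologicalSpace G]

lemma latticeAction_properlyDiscontinuous :
    letI := latticeAction ψ ρ
    ProperlyDiscontinuousSMul (Multiplicative (Fin n → ℤ))
      (K × G × EuclideanSpace ℝ (Fin n)) := by
  let := latticeAction ψ ρ
  refine ⟨fun {C D} hC hD => ?_⟩
  have hc : Continuous fun x : K × G × EuclideanSpace ℝ (Fin n) => x.2.2 := by fun_prop
  obtain ⟨R, hR⟩ := (hC.image hc).isBounded.exists_norm_le
  obtain ⟨R', hR'⟩ := (hD.image hc).isBounded.exists_norm_le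
  refine (finite_latticeVec_norm_le (R' + R)).subset ?_
  rintro m ⟨-, ⟨x, hx, rfl⟩, hmx⟩
  have h1 := hR _ ⟨x, hx, rfl⟩
  have h2 : ‖x.2.2 + latticeVec m‖ ≤ R' := hR' _ ⟨_, hmx, rfl⟩
  calc ‖latticeVec m‖ = ‖(x.2.2 + latticeVec m) - x.2.2‖ := by rw [add_sub_cancel_left]
    _ ≤ ‖x.2.2 + latticeVec m‖ + ‖x.2.2‖ := norm_sub_le _ _
    _ ≤ R' + R := add_le_add h2 h1

variable {ψ ρ} in
/-- The topology of the quotient. -/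
lemma latticeQuotient_topology [T2Space K] [T2Space G] [LocallyCompactSpace K]
    [LocallyCompactSpace G] [SecondCountableTopology K] [SecondCountableTopology G]
    (hψ : ∀ m, Continuous (ψ m : Equiv.Perm K)) (hρ : ∀ m, Continuous (ρ m : Equiv.Perm G)) :
    T2Space (LatticeQuotient ψ ρ) ∧ SecondCountableTopology (LatticeQuotient ψ ρ) ∧
      IsLocalHomeomorph (LatticeQuotient.mk ψ ρ) := by
  let := latticeAction ψ ρ
  have := latticeAction_properlyDiscontinuous ψ ρ
  have : ContinuousConstSMul (Multiplicative (Fin n → ℤ)) (K × G × EuclideanSpace ℝ (Fin n)) :=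
    ⟨fun m => ((hψ m).comp continuous_fst).prodMk (((hρ m).comp
      (continuous_fst.comp continuous_snd)).prodMk
        ((continuous_snd.comp continuous_snd).add continuous_const))⟩
  have : IsCancelSMul (Multiplicative (Fin n → ℤ)) (K × G × EuclideanSpace ℝ (Fin n)) :=
    isCancelSMul_iff_eq_one_of_smul_eq.2 (latticeAction_free ψ ρ)
  exact ⟨t2Space_of_properlyDiscontinuousSMul_of_t2Space,
    ContinuousConstSMul.secondCountableTopology (Γ := Multiplicative (Fin n → ℤ)),
    (isQuotientCoveringMap_quotientMk_of_properlyDiscontinuousSMul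
      (G := Multiplicative (Fin n → ℤ))).isCoveringMap.isLocalHomeomorph⟩

lemma latticeQuotient_mk_surjective : Function.Surjective (LatticeQuotient.mk ψ ρ) :=
  Quotient.mk_surjective

lemma latticeQuotient_mk_eq_iff {x y : K × G × EuclideanSpace ℝ (Fin n)} :
    LatticeQuotient.mk ψ ρ x = LatticeQuotient.mk ψ ρ y ↔
      ∃ m, ((ψ m : Equiv.Perm K) x.1, (ρ m : Equiv.Perm G) x.2.1, x.2.2 + latticeVec m) = y := by
  let := latticeAction ψ ρ
  refine Quotient.eq''.trans ⟨?_, ?_⟩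
  · intro h
    obtain ⟨m, hm⟩ := (MulAction.orbitRel _ _).symm h
    exact ⟨m, hm⟩
  · rintro ⟨m, hm⟩
    exact (MulAction.orbitRel _ _).symm ⟨m, hm⟩

end LatticeAction

end

theorem mainTheorem8
    -- the compact Kähler manifold `(K, g, J)`
    {EK : Type*} [NormedAddCommGroup EK] [NormedSpace ℝ EK] [FiniteDimensional ℝ EK]
    {K : Type*} [TopologicalSpace K] [ChartedSpace EK K] [IsManifold 𝓘(ℝ, EK) ∞ K]
    [T2Space K] [CompactSpace K]
    (gJ : HermitianStructure 𝓘(ℝ, EK) K) (hKahler : gJ.IsKahler)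
    -- the compact, simply connected, semisimple Lie group `G` with bi-invariant metric `b`
    {EG : Type*} [NormedAddCommGroup EG] [NormedSpace ℝ EG] [FiniteDimensional ℝ EG]
    {G : Type*} [TopologicalSpace G] [ChartedSpace EG G] [Group G] [LieGroup 𝓘(ℝ, EG) ∞ G]
    [T2Space G] [CompactSpace G] [SimplyConnectedSpace G]
    (hss : IsSemisimpleLieGroup 𝓘(ℝ, EG) G) (hdim : 3 ≤ Module.finrank ℝ EG)
    (b : SmoothMetric 𝓘(ℝ, EG) G) (hb : IsBiInvariantMetric 𝓘(ℝ, EG) b.inner)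
    -- the complex structures `J_L` and `J_R` on `G' = G × ℝⁿ`, compatible with `g' = b + g_E`
    (n : ℕ)
    (JL JR : EndField (𝓘(ℝ, EG).prod 𝓘(ℝ, EuclideanSpace ℝ (Fin n)))
      (G × EuclideanSpace ℝ (Fin n)))
    (hJL : IsComplexStructure JL) (hJR : IsComplexStructure JR)
    (hJLg : IsCompatible (prodBilin b.inner (euclideanBilin n)) JL)
    (hJRg : IsCompatible (prodBilin b.inner (euclideanBilin n)) JR)
    (hJLinv : IsLeftInvariant JL) (hJRinv : IsRightInvariant JR)
    -- the homomorphisms `ψ : ℤⁿ → Isom_hol(K)` and `ρ : ℤⁿ → Isom(G)`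
    (ψ : Multiplicative (Fin n → ℤ) →* holIsomGroup gJ)
    (ρ : Multiplicative (Fin n → ℤ) →* isomGroup b)
    (hρL : ∀ m, Intertwines
      (fun x : G × EuclideanSpace ℝ (Fin n) => ((ρ m : Equiv.Perm G) x.1, x.2 + latticeVec m))
      JL JL)
    (hρR : ∀ m, Intertwines
      (fun x : G × EuclideanSpace ℝ (Fin n) => ((ρ m : Equiv.Perm G) x.1, x.2 + latticeVec m))
      JR JR) :
    -- the action is free and properly discontinuous
    (letI := latticeAction ψ ρ;
      (∀ (m : Multiplicative (Fin n → ℤ)) (x : K × G × EuclideanSpace ℝ (Fin n)),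
        m • x = x → m = 1) ∧
      ProperlyDiscontinuousSMul (Multiplicative (Fin n → ℤ))
        (K × G × EuclideanSpace ℝ (Fin n))) ∧
    -- the quotient is a smooth manifold, locally diffeomorphic to `K × G × ℝⁿ` by the projection
    T2Space (LatticeQuotient ψ ρ) ∧ SecondCountableTopology (LatticeQuotient ψ ρ) ∧
    ∃ (_ : ChartedSpace (ModelProd EK (ModelProd EG (EuclideanSpace ℝ (Fin n))))
        (LatticeQuotient ψ ρ))
      (_ : IsManifold (𝓘(ℝ, EK).prod (𝓘(ℝ, EG).prod 𝓘(ℝ, EuclideanSpace ℝ (Fin n)))) ∞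
        (LatticeQuotient ψ ρ)),
      IsLocalDiffeomorph (𝓘(ℝ, EK).prod (𝓘(ℝ, EG).prod 𝓘(ℝ, EuclideanSpace ℝ (Fin n))))
        (𝓘(ℝ, EK).prod (𝓘(ℝ, EG).prod 𝓘(ℝ, EuclideanSpace ℝ (Fin n)))) ∞
        (LatticeQuotient.mk ψ ρ) ∧
      -- it has a generalized Kähler structure induced by `g + b + g_E`, `J × J_R` and `J × J_L`
      ∃ S : GeneralizedKahlerStructure
          (𝓘(ℝ, EK).prod (𝓘(ℝ, EG).prod 𝓘(ℝ, EuclideanSpace ℝ (Fin n)))) (LatticeQuotient ψ ρ),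
        PullsBackMetric (LatticeQuotient.mk ψ ρ)
          (prodBilin gJ.metric.inner (prodBilin b.inner (euclideanBilin n)))
          S.plus.metric.inner ∧
        Intertwines (LatticeQuotient.mk ψ ρ) (prodEnd gJ.J JR) S.plus.J ∧
        Intertwines (LatticeQuotient.mk ψ ρ) (prodEnd gJ.J JL) S.minus.J := by
  have hK : LocallyCompactSpace K := ChartedSpace.locallyCompactSpace EK K
  have hG : LocallyCompactSpace G := ChartedSpace.locallyCompactSpace EG G
  have hK' : SecondCountableTopology K := ChartedSpace.secondCountable_of_sigmaCompact EK K
  have hG' : SecondCountableTopology G := ChartedSpace.secondCountable_of_sigmaCompact EG G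
  have hψ : ∀ m, ContMDiff 𝓘(ℝ, EK) 𝓘(ℝ, EK) ∞ (ψ m : Equiv.Perm K) := fun m => (ψ m).2.1.1
  have hρ : ∀ m, ContMDiff 𝓘(ℝ, EG) 𝓘(ℝ, EG) ∞ (ρ m : Equiv.Perm G) := fun m => (ρ m).2.1
  obtain ⟨hT2, hSC, hloc⟩ := latticeQuotient_topology (ψ := ψ) (ρ := ρ)
    (fun m => (hψ m).continuous) fun m => (hρ m).continuous
  refine ⟨⟨latticeAction_free ψ ρ, latticeAction_properlyDiscontinuous ψ ρ⟩, hT2, hSC, ?_⟩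
  have hsurj := latticeQuotient_mk_surjective ψ ρ
  have hρs : ∀ m, ContMDiff (𝓘(ℝ, EG).prod 𝓘(ℝ, EuclideanSpace ℝ (Fin n)))
      (𝓘(ℝ, EG).prod 𝓘(ℝ, EuclideanSpace ℝ (Fin n))) ∞
      (fun x : G × EuclideanSpace ℝ (Fin n) =>
        ((ρ m : Equiv.Perm G) x.1, x.2 + latticeVec m)) := fun m =>
    ((hρ m).comp contMDiff_fst).prodMk (contMDiff_snd.add contMDiff_const)
  have hs : ∀ m, ContMDiff (𝓘(ℝ, EK).prod (𝓘(ℝ, EG).prod 𝓘(ℝ, EuclideanSpace ℝ (Fin n))))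
      (𝓘(ℝ, EK).prod (𝓘(ℝ, EG).prod 𝓘(ℝ, EuclideanSpace ℝ (Fin n)))) ∞
      (fun x : K × G × EuclideanSpace ℝ (Fin n) => ((ψ m : Equiv.Perm K) x.1,
        (ρ m : Equiv.Perm G) x.2.1, x.2.2 + latticeVec m)) := fun m =>
    ((hψ m).comp contMDiff_fst).prodMk ((hρs m).comp contMDiff_snd)
  have hmk : ∀ m (z : K × G × EuclideanSpace ℝ (Fin n)), LatticeQuotient.mk ψ ρ
      ((ψ m : Equiv.Perm K) z.1, (ρ m : Equiv.Perm G) z.2.1, z.2.2 + latticeVec m) =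
        LatticeQuotient.mk ψ ρ z := fun m z =>
    ((latticeQuotient_mk_eq_iff ψ ρ).2 ⟨m, rfl⟩).symm
  obtain ⟨cs, hmf, hdiff⟩ := exists_isManifold_quotient
    (I := 𝓘(ℝ, EK).prod (𝓘(ℝ, EG).prod 𝓘(ℝ, EuclideanSpace ℝ (Fin n)))) hloc hsurj
    fun x y hxy => by
      obtain ⟨m, rfl⟩ := (latticeQuotient_mk_eq_iff ψ ρ).1 hxy
      exact ⟨_, hs m, rfl, hmk m⟩
  refine ⟨cs, hmf, hdiff, ?_⟩
  let TR : HermitianStructure (𝓘(ℝ, EG).prod 𝓘(ℝ, EuclideanSpace ℝ (Fin n)))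
      (G × EuclideanSpace ℝ (Fin n)) := ⟨prodMetric b (euclideanMetric n), JR, hJR, hJRg⟩
  let TL : HermitianStructure (𝓘(ℝ, EG).prod 𝓘(ℝ, EuclideanSpace ℝ (Fin n)))
      (G × EuclideanSpace ℝ (Fin n)) := ⟨prodMetric b (euclideanMetric n), JL, hJL, hJLg⟩
  have htor := torsion_prodVectorGroup hb (S := TR) (T := TL) rfl rfl hJRinv hJLinv
  let S := gJ.prodGeneralizedKahler hKahler ⟨TR, TL, rfl, htor.1, htor.2⟩
  refine exists_generalizedKahler_descend hdiff hsurj S fun x y hxy => ?_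
  obtain ⟨m, rfl⟩ := (latticeQuotient_mk_eq_iff ψ ρ).1 hxy
  exact ⟨_, hs m, rfl, hmk m,
    PullsBackMetric.prodMap (hψ m) (hρs m) (ψ m).2.1.2.2
      (PullsBackMetric.prodMap (hρ m) (contMDiff_id.add contMDiff_const) (ρ m).2.2.2
        (pullsBackMetric_add_const _)),
    Intertwines.prodMap (hψ m) (hρs m) (ψ m).2.2 (hρR m),
    Intertwines.prodMap (hψ m) (hρs m) (ψ m).2.2 (hρL m)⟩
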